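/- **Setting.** A *key* is a pair of distinct odd primes $p,q$ with $p\nmid q-1$ and $q\nmid p-1$; put $n=pq$ (the public key) and let the secret key be $sk=\phi(n)=(p-1)(q-1)$, where $\phi$ is Euler's function. Then $\gcd(n,\phi(n))=1$, so $\phi(n)\in\mathbb Z_n^*$. For $\zeta,\eta_0,\eta_1\in\mathbb Z_n^*$ the *comparison key* is $$ck=\bigl(\eta_0\cdot\phi(n)^{\zeta}\bmod n,\ \ \eta_1\cdot(\phi(n)^{\zeta})^{-1}\bmod n\bigr),$$ where the exponent is the representative of $\zeta$ in $\{1,\dots,n-1\}$. Let $\mathrm{Gen}$ be any key generator: for every security parameter $\kappa\in\mathbb N$, a probability distribution $\mathrm{Gen}(\kappa)$ on keys. A *PPT algorithm* is a probabilistic algorithm (a program of a random access machine with logarithmic cost and fair coins) that, on all inputs and for all outcomes of its coins, halts within time polynomial in the length of the input; the security parameter is given in unary ($1^\kappa$), the other inputs are natural numbers in binary. A function $\mu:\mathbb N\to\mathbb R$ is *negligible* if $\kappa^c\mu(\kappa)\to0$ as $\kappa\to\infty$ for every $c\in\mathbb N$. **Assumption (intractability of the $n$-th residue problem).** The problem is: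 given $n$ and $h\in\mathbb Z_{n^2}^*$, is there $g\in\mathbb Z_{n^2}^*$ with $g^n\equiv h \pmod{n^2}$? It is *intractable* for $\mathrm{Gen}$ if for every PPT algorithm $D$ the function $$\kappa\mapsto\bigl|\Pr[D(1^\kappa,n,h)=1]-\Pr[D(1^\kappa,n,h')=1]\bigr|$$ is negligible, where $n$ comes from a key drawn from $\mathrm{Gen}(\kappa)$, $h$ is uniform among the elements of $\mathbb Z_{n^2}^*$ that are $n$-th powers, $h'$ is uniform among those that are not, and the probabilities are also over the coins of $D$. **Theorem.** Suppose that the $n$-th residue problem is intractable for $\mathrm{Gen}$. Then no PPT algorithm recovers the secret key from the comparison key: for every PPT algorithm $\mathcal A$, the function $$\kappa\mapsto\Pr\bigl[\mathcal A(1^\kappa,n,ck)=\phi(n)\bigr]$$ is negligible, where the key is drawn from $\mathrm{Gen}(\kappa)$, $\zeta,\eta_0,\eta_1$ are independent and uniform in $\mathbb Z_n^*$, $ck$ is the resulting comparison key, and the probability is also over the coins of $\mathcal A$. -/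

import Mathlib

open scoped ENNReal

noncomputable section

namespace HOPE

/-! ### Probabilistic polynomial time

The machine model is the random access machine with logarithmic cost, plus a fair coin. Registers
hold natural numbers; a program is a structured program over finitely many registers; every
instruction is charged `1` plus the bit lengths of the numbers that it reads. -/

/-- Arithmetic operations on natural numbers: subtraction is truncated,
`x div 0 = 0` and `x mod 0 = x`. -/
inductive ArithOp where
  | add | sub | mul | div | mod

/-- The value of an arithmetic operation. -/
def ArithOp.apply : ArithOp → ℕ → ℕ → ℕ
  | .add, x, y => x + y
  | .sub, x, y => x - y
  | .mul, x, y => x * y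
  | .div, x, y => x / y
  | .mod, x, y => x % y

/-- Programs. Registers are named by natural numbers. -/
inductive Prog where
  /-- `R_d := c` -/
  | const (d c : ℕ)
  /-- `R_d := R_a op R_b` -/
  | arith (op : ArithOp) (d a b : ℕ)
  /-- `R_d :=` a fair random bit -/
  | flip (d : ℕ)
  /-- `p; q` -/
  | seq (p q : Prog)
  /-- `if R_a ≠ 0 then p else q` -/
  | ite (a : ℕ) (p q : Prog)
  /-- `while R_a ≠ 0 do p` -/
  | loop (a : ℕ) (p : Prog)

/-- A machine state: the contents of the registers and the running time spent so far. -/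
@[ext] structure MState where
  reg : ℕ → ℕ
  clock : ℕ

/-- Spend `t` units of time. -/
def MState.tick (s : MState) (t : ℕ) : MState := ⟨s.reg, s.clock + t⟩

/-- Write the value `v` into register `d`, spending `t` units of time. -/
def MState.write (s : MState) (d v t : ℕ) : MState := ⟨Function.update s.reg d v, s.clock + t⟩

/-- Sequential composition of randomized partial computations; `none` means "not finished". -/
def andThen {α β : Type} (m : PMF (Option α)) (f : α → PMF (Option β)) : PMF (Option β) :=
  m.bind fun o => o.elim (PMF.pure none) f

/-- `while R_a ≠ 0 do body`, cut off (with result `none`) when the loop test has been evaluated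
`fuel` times without leaving the loop. -/
def iterLoop (a : ℕ) (body : MState → PMF (Option MState)) : ℕ → MState → PMF (Option MState)
  | 0, _ => PMF.pure none
  | fuel + 1, s =>
      if s.reg a = 0 then PMF.pure (some (s.tick (1 + (s.reg a).size)))
      else andThen (body (s.tick (1 + (s.reg a).size))) (iterLoop a body fuel)

/-- The distribution of the final state of a program started in a given state, where each execution
of a loop is cut off (with result `none`) after `fuel` tests. -/
def Prog.eval (fuel : ℕ) : Prog → MState → PMF (Option MState)
  | .const d c, s => PMF.pure (some (s.write d c (1 + c.size)))
  | .arith op d a b, s => PMF.pure (some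
      (s.write d (op.apply (s.reg a) (s.reg b)) (1 + (s.reg a).size + (s.reg b).size)))
  | .flip d, s => (PMF.uniformOfFintype Bool).bind fun b => PMF.pure (some (s.write d b.toNat 1))
  | .seq p q, s => andThen (p.eval fuel s) (q.eval fuel)
  | .ite a p q, s =>
      if s.reg a = 0 then q.eval fuel (s.tick (1 + (s.reg a).size))
      else p.eval fuel (s.tick (1 + (s.reg a).size))
  | .loop a p, s => iterLoop a (p.eval fuel) fuel s

/-- The initial state: the security parameter `κ` in register `0`, the inputs `xs` in the registers
`1, 2, …`, and `0` in all other registers. -/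
def initState (κ : ℕ) (xs : List ℕ) : MState := ⟨fun i => (κ :: xs).getD i 0, 0⟩

/-- The length of the input `(1^κ, xs)`: the security parameter counts in unary, the other inputs
in binary. -/
def inputLength (κ : ℕ) (xs : List ℕ) : ℕ := κ + (xs.map Nat.size).sum

/-- `A` is a probabilistic polynomial time algorithm with `m` inputs besides the security parameter:
for all inputs and all outcomes of the coins it halts within time polynomial in the
length of the input. -/
def IsPPT (m : ℕ) (A : Prog) : Prop :=
  ∃ T : Polynomial ℕ, ∀ (κ : ℕ) (xs : List ℕ), xs.length = m →
    ∃ fuel : ℕ, ∀ o ∈ (A.eval fuel (initState κ xs)).support,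
      ∃ s : MState, o = some s ∧ s.clock ≤ T.eval (inputLength κ xs)

/-- The probability, over the coins of `A`, that `A` on input `(1^κ, xs)` halts with
output `y` (in register `0`). -/
def Prog.outputProb (A : Prog) (κ : ℕ) (xs : List ℕ) (y : ℕ) : ℝ≥0∞ :=
  ⨆ fuel : ℕ, ((A.eval fuel (initState κ xs)).map (Option.map fun s => s.reg 0)) (some y)

/-- A function of the security parameter is negligible if it tends to `0` faster than the inverse
of every polynomial. -/
def Negligible (f : ℕ → ℝ) : Prop :=
  Asymptotics.SuperpolynomialDecay Filter.atTop (fun κ : ℕ => (κ : ℝ)) f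

/-! ### Keys -/

/-- The primes behind a key pair: two distinct odd primes, neither of which divides the other
minus one. -/
structure Key where
  p : ℕ
  q : ℕ
  p_prime : p.Prime
  q_prime : q.Prime
  p_odd : Odd p
  q_odd : Odd q
  p_ne_q : p ≠ q
  not_p_dvd : ¬ p ∣ q - 1
  not_q_dvd : ¬ q ∣ p - 1

/-- The public key, i.e. the modulus `n = p q`. -/
def Key.n (k : Key) : ℕ := k.p * k.q

/-- The secret key `φ(n)`. -/
def Key.sk (k : Key) : ℕ := Nat.totient k.n

instance (k : Key) : NeZero k.n := ⟨(Nat.mul_pos k.p_prime.pos k.q_prime.pos).ne'⟩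

theorem Key.sk_eq (k : Key) : k.sk = (k.p - 1) * (k.q - 1) := by
  rw [Key.sk, Key.n, Nat.totient_mul ((Nat.coprime_primes k.p_prime k.q_prime).2 k.p_ne_q),
    Nat.totient_prime k.p_prime, Nat.totient_prime k.q_prime]

theorem Key.coprime_sk (k : Key) : Nat.Coprime k.sk k.n := by
  have aux : ∀ r : ℕ, r.Prime → ¬ r ∣ r - 1 := fun r hr h =>
    absurd (Nat.le_of_dvd (Nat.sub_pos_of_lt hr.one_lt) h) (by have := hr.pos; omega)
  rw [k.sk_eq, Key.n]
  apply Nat.Coprime.mul_right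
  · refine Nat.Coprime.symm ((Nat.Prime.coprime_iff_not_dvd k.p_prime).2 fun h => ?_)
    rcases k.p_prime.dvd_mul.1 h with h | h
    · exact aux _ k.p_prime h
    · exact k.not_p_dvd h
  · refine Nat.Coprime.symm ((Nat.Prime.coprime_iff_not_dvd k.q_prime).2 fun h => ?_)
    rcases k.q_prime.dvd_mul.1 h with h | h
    · exact k.not_q_dvd h
    · exact aux _ k.q_prime h

/-- `φ(n)` as an element of `ℤ_n^*`. -/
def Key.phi (k : Key) : (ZMod k.n)ˣ := ZMod.unitOfCoprime k.sk k.coprime_sk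

/-- The comparison key `(η₀ · φ(n)^ζ mod n, η₁ · (φ(n)^ζ)⁻¹ mod n)`, with both entries in
`{0, …, n-1}`; the exponent is the representative of `ζ` in `{0, …, n-1}`. -/
def Key.comparisonKey (k : Key) (ζ η₀ η₁ : (ZMod k.n)ˣ) : ℕ × ℕ :=
  (((η₀ * k.phi ^ (ζ : ZMod k.n).val : (ZMod k.n)ˣ) : ZMod k.n).val,
    ((η₁ * (k.phi ^ (ζ : ZMod k.n).val)⁻¹ : (ZMod k.n)ˣ) : ZMod k.n).val)

/-- A comparison key for `k` with `ζ, η₀, η₁` independent and uniform in `ℤ_n^*`. -/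
def Key.randomComparisonKey (k : Key) : PMF (ℕ × ℕ) :=
  (PMF.uniformOfFintype (ZMod k.n)ˣ).bind fun ζ =>
    (PMF.uniformOfFintype (ZMod k.n)ˣ).bind fun η₀ =>
      (PMF.uniformOfFintype (ZMod k.n)ˣ).bind fun η₁ =>
        PMF.pure (k.comparisonKey ζ η₀ η₁)

/-- The probability that `A`, given `1^κ`, the public key `n` and the comparison key, outputs the
secret key `φ(n)`, when the key is drawn from `Gen κ`. -/
def keyRecoveryProb (Gen : ℕ → PMF Key) (A : Prog) (κ : ℕ) : ℝ≥0∞ :=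
  ∑' k : Key, Gen κ k * ∑' ck : ℕ × ℕ,
    k.randomComparisonKey ck * A.outputProb κ [k.n, ck.1, ck.2] k.sk

/-! ### The `n`-th residue problem -/

/-- `h ∈ ℤ_{n²}^*` is an `n`-th residue modulo `n²`. -/
def Key.IsNthResidue (k : Key) (h : (ZMod (k.n ^ 2))ˣ) : Prop :=
  ∃ g : (ZMod (k.n ^ 2))ˣ, g ^ k.n = h

instance (k : Key) : Nonempty {h : (ZMod (k.n ^ 2))ˣ // k.IsNthResidue h} :=
  ⟨⟨1, 1, one_pow _⟩⟩

instance (k : Key) : Nonempty {h : (ZMod (k.n ^ 2))ˣ // ¬ k.IsNthResidue h} := by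
  have : Fact k.p.Prime := ⟨k.p_prime⟩
  have hdvd : k.p ∣ Fintype.card (ZMod (k.n ^ 2))ˣ := by
    have hn : k.n ^ 2 = k.p * (k.p * (k.q * k.q)) := by rw [Key.n]; ring
    rw [ZMod.card_units_eq_totient, hn,
      Nat.totient_mul_of_prime_of_dvd k.p_prime (Dvd.intro _ rfl)]
    exact Dvd.intro _ rfl
  by_contra hcon
  rw [not_nonempty_iff, isEmpty_subtype] at hcon
  have hsurj : Function.Surjective fun g : (ZMod (k.n ^ 2))ˣ => g ^ k.n :=
    fun h => not_not.1 (hcon h)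
  have hinj := Finite.injective_iff_surjective.2 hsurj
  obtain ⟨x, hx⟩ := exists_prime_orderOf_dvd_card k.p hdvd
  have hx1 : x = 1 := hinj (by
    change x ^ k.n = 1 ^ k.n
    rw [one_pow, ← orderOf_dvd_iff_pow_eq_one, hx]
    exact Dvd.intro _ rfl)
  rw [hx1, orderOf_one] at hx
  exact k.p_prime.one_lt.ne hx

open scoped Classical in
/-- A uniformly random `n`-th residue modulo `n²`. -/
def Key.randomResidue (k : Key) : PMF {h : (ZMod (k.n ^ 2))ˣ // k.IsNthResidue h} :=
  PMF.uniformOfFintype _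

open scoped Classical in
/-- A uniformly random element of `ℤ_{n²}^*` that is not an `n`-th residue modulo `n²`. -/
def Key.randomNonresidue (k : Key) : PMF {h : (ZMod (k.n ^ 2))ˣ // ¬ k.IsNthResidue h} :=
  PMF.uniformOfFintype _

/-- The probability that `D`, given `1^κ`, `n` and a random `n`-th residue, answers `1` (yes). -/
def acceptResidueProb (Gen : ℕ → PMF Key) (D : Prog) (κ : ℕ) : ℝ≥0∞ :=
  ∑' k : Key, Gen κ k * ∑' h, k.randomResidue h *
    D.outputProb κ [k.n, (h.1 : ZMod (k.n ^ 2)).val] 1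

/-- The probability that `D`, given `1^κ`, `n` and a random non-residue, answers `1` (yes). -/
def acceptNonresidueProb (Gen : ℕ → PMF Key) (D : Prog) (κ : ℕ) : ℝ≥0∞ :=
  ∑' k : Key, Gen κ k * ∑' h, k.randomNonresidue h *
    D.outputProb κ [k.n, (h.1 : ZMod (k.n ^ 2)).val] 1

/-- The `n`-th residue problem (given `h ∈ ℤ_{n²}^*`, is there `g ∈ ℤ_{n²}^*` with
`g ^ n = h mod n²`?) is intractable for moduli drawn from `Gen`: every probabilistic polynomial
time algorithm has negligible advantage in telling yes-instances from no-instances. -/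
def NthResidueIntractable (Gen : ℕ → PMF Key) : Prop :=
  ∀ D : Prog, IsPPT 2 D → Negligible fun κ =>
    |(acceptResidueProb Gen D κ).toReal - (acceptNonresidueProb Gen D κ).toReal|

end HOPE

end

namespace HOPE

/-! ### Semantics of programs -/

/-! The comparison key carries no information beyond `n`: for every `ζ`, multiplication by a fixed
unit permutes `ℤ_n^*`, so the masks `η₀, η₁` make its entries independent uniform units
(`Key.tsum_randomComparisonKey`). Hence an algorithm `A` that recovers `φ(n)` from it also finds
`φ(n)` from `n` and random numbers. Strings of random bits as long as `n` suffice: units make up at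
least 1/8 of them, so two entries cost a factor 64 (`Key.recovery_le_guessProb`).

Knowledge of `φ(n)` decides residuosity. Since `φ(n²) = n φ(n)` and `n` is prime to `φ(n)`, the
`n`-th powers modulo `n²` are exactly the `h` with `h ^ φ(n) = 1` (`Key.pow_sk_eq_one_iff`). The
distinguisher runs `A` on random numbers and accepts when its output `s` satisfies `h ^ s = 1`. The
output `s = φ(n)` accepts every residue and no non-residue. Any other `s` does no harm: the subgroup
of `h` with `h ^ s = 1` meets the subgroup of residues in at least its proportional share, so
residues are accepted at least as often as non-residues (`Key.prob_pow_eq_one_le`). The advantage is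
therefore at least the probability of guessing `φ(n)`, hence at least 1/64 of the recovery
probability.

The rest is about the machine. Acceptance probabilities are computed with an expectation transformer
`Prog.exp`, running times with a total correctness logic `Prog.Total`; both rest on monotonicity in
the fuel and on the fact that a program ignores the clock and the registers it does not name
(`Prog.eval_overlay`). -/

theorem andThen_apply_some {α β : Type} (m : PMF (Option α)) (f : α → PMF (Option β)) (y : β) :
    andThen m f (some y) = ∑' x, m (some x) * f x (some y) := by
  rw [andThen, PMF.bind_apply]
  refine ((Option.some_injective α).tsum_eq ?_).symm
  rintro (_ | x) h
  · simp [PMF.pure_apply] at h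
  · exact ⟨x, rfl⟩

theorem mem_support_andThen {α β : Type} {m : PMF (Option α)} {f : α → PMF (Option β)}
    {o : Option β} :
    o ∈ (andThen m f).support ↔
      (none ∈ m.support ∧ o = none) ∨ ∃ x, some x ∈ m.support ∧ o ∈ (f x).support := by
  rw [andThen, PMF.mem_support_bind_iff, Option.exists]
  simp only [Option.elim, PMF.support_pure, Set.mem_singleton_iff]

theorem map_andThen {α β γ : Type} (m : PMF (Option α)) (g : α → β) (f : β → PMF (Option γ)) :
    andThen (m.map (Option.map g)) f = andThen m fun x => f (g x) := by
  rw [andThen, PMF.bind_map, andThen]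
  congr 1
  funext o
  cases o <;> rfl

theorem andThen_map {α β γ : Type} (m : PMF (Option α)) (f : α → PMF (Option β)) (g : β → γ) :
    (andThen m f).map (Option.map g) = andThen m fun x => (f x).map (Option.map g) := by
  rw [andThen, PMF.map_bind, andThen]
  congr 1
  funext o
  cases o
  · simp [PMF.pure_map]
  · rfl

/-- Both sides have total mass 1, so domination leaves no room for a difference. Thus extra fuel
does not change a run that has certainly finished. -/
theorem pmf_eq_of_some_le {α : Type} {m m' : PMF (Option α)} (hm : none ∉ m.support)
    (h : ∀ x, m (some x) ≤ m' (some x)) : m' = m := by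
  have hle : ∀ o, m o ≤ m' o := by
    rintro (_ | x)
    · rw [(PMF.apply_eq_zero_iff _ _).2 hm]; exact zero_le
    · exact h x
  refine PMF.ext fun o => le_antisymm ?_ (hle o)
  by_contra hlt
  have := ENNReal.tsum_lt_tsum (m.tsum_coe ▸ ENNReal.one_ne_top) hle (not_le.1 hlt)
  rw [m.tsum_coe, m'.tsum_coe] at this
  exact lt_irrefl _ this

theorem iterLoop_mono {a : ℕ} {b b' : MState → PMF (Option MState)}
    (hb : ∀ s t, b s (some t) ≤ b' s (some t)) :
    ∀ {c c' : ℕ}, c ≤ c' → ∀ s t, iterLoop a b c s (some t) ≤ iterLoop a b' c' s (some t)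
  | 0, _, _, s, t => by simp [iterLoop]
  | c + 1, 0, h, s, t => by omega
  | c + 1, c' + 1, h, s, t => by
    rw [iterLoop, iterLoop]
    split_ifs
    · exact le_rfl
    · rw [andThen_apply_some, andThen_apply_some]
      exact ENNReal.tsum_le_tsum fun x =>
        mul_le_mul' (hb _ _) (iterLoop_mono hb (by omega) _ _)

theorem Prog.eval_mono {F F' : ℕ} (h : F ≤ F') (p : Prog) :
    ∀ s t, p.eval F s (some t) ≤ p.eval F' s (some t) := by
  induction p with
  | const d c => intro s t; exact le_rfl
  | arith op d a b => intro s t; exact le_rfl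
  | flip d => intro s t; exact le_rfl
  | seq p q hp hq =>
    intro s t
    rw [Prog.eval, Prog.eval, andThen_apply_some, andThen_apply_some]
    exact ENNReal.tsum_le_tsum fun x => mul_le_mul' (hp _ _) (hq _ _)
  | ite a p q hp hq =>
    intro s t
    rw [Prog.eval, Prog.eval]
    split_ifs
    · exact hq _ _
    · exact hp _ _
  | loop a p hp => intro s t; exact iterLoop_mono hp h s t

theorem Prog.eval_eq_of_le {F F' : ℕ} (h : F ≤ F') {p : Prog} {s : MState}
    (hn : none ∉ (p.eval F s).support) : p.eval F' s = p.eval F s :=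
  pmf_eq_of_some_le hn (p.eval_mono h s)

theorem finite_support_andThen {α β : Type} {m : PMF (Option α)} {f : α → PMF (Option β)}
    (hm : m.support.Finite) (hf : ∀ x, (f x).support.Finite) : (andThen m f).support.Finite := by
  rw [andThen, PMF.support_bind]
  refine hm.biUnion fun o _ => ?_
  cases o
  · simp [PMF.support_pure]
  · exact hf _

theorem Prog.finite_support_eval (F : ℕ) (p : Prog) : ∀ s, (p.eval F s).support.Finite := by
  induction p with
  | const d c => intro s; simp [Prog.eval, PMF.support_pure]
  | arith op d a b => intro s; simp [Prog.eval, PMF.support_pure]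
  | flip d =>
    intro s
    rw [Prog.eval, PMF.support_bind]
    exact (Set.toFinite _).biUnion fun b _ => by simp [PMF.support_pure]
  | seq p q hp hq => intro s; exact finite_support_andThen (hp _) hq
  | ite a p q hp hq =>
    intro s
    rw [Prog.eval]
    split_ifs
    · exact hq _
    · exact hp _
  | loop a p hp =>
    have : ∀ c s, (iterLoop a (p.eval F) c s).support.Finite := by
      intro c
      induction c with
      | zero => intro s; simp [iterLoop, PMF.support_pure]
      | succ c ih =>
        intro s
        rw [iterLoop]
        split_ifs
        · simp [PMF.support_pure]
        · exact finite_support_andThen (hp _) ih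
    exact this F

/-! ### Total correctness for all outcomes of the coins -/

/-- Started in `s`, the program halts for all outcomes of the coins, in a state that
satisfies `Q`. -/
def Prog.Total (p : Prog) (s : MState) (Q : MState → Prop) : Prop :=
  ∃ F : ℕ, ∀ o ∈ (p.eval F s).support, ∃ s', o = some s' ∧ Q s'

theorem none_notMem_of_forall {α : Type} {m : PMF (Option α)} {Q : α → Prop}
    (h : ∀ o ∈ m.support, ∃ s, o = some s ∧ Q s) : none ∉ m.support := by
  intro hn
  obtain ⟨s, hs, -⟩ := h _ hn
  cases hs

theorem Prog.Total.mono {p : Prog} {s : MState} {Q Q' : MState → Prop} (h : p.Total s Q)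
    (hQ : ∀ s, Q s → Q' s) : p.Total s Q' := by
  obtain ⟨F, hF⟩ := h
  exact ⟨F, fun o ho => let ⟨s', h1, h2⟩ := hF o ho; ⟨s', h1, hQ _ h2⟩⟩

/-- A common amount of fuel for finitely many runs. -/
theorem exists_fuel {S : Set (Option MState)} (hS : S.Finite) {R : MState → ℕ → Prop}
    (h : ∀ s, some s ∈ S → ∃ F, R s F) : ∃ F, ∀ s, some s ∈ S → ∃ F' ≤ F, R s F' := by
  choose! g hg using h
  obtain ⟨F, hF⟩ := (hS.image fun o => o.elim 0 g).bddAbove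
  exact ⟨F, fun s hs => ⟨g s, hF ⟨some s, hs, rfl⟩, hg s hs⟩⟩

theorem Prog.Total.seq {p q : Prog} {s : MState} {Q : MState → Prop}
    (h : p.Total s fun s' => q.Total s' Q) : (Prog.seq p q).Total s Q := by
  obtain ⟨F, hF⟩ := h
  obtain ⟨G, hG⟩ := exists_fuel (p.finite_support_eval F s)
    (R := fun s' F => ∀ o ∈ (q.eval F s').support, ∃ t, o = some t ∧ Q t) (by
      intro s' hs'
      obtain ⟨t, ht, hQ⟩ := hF _ hs'
      cases ht
      exact hQ)
  refine ⟨max F G, fun o ho => ?_⟩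
  rw [Prog.eval, Prog.eval_eq_of_le (le_max_left F G) (none_notMem_of_forall hF),
    mem_support_andThen] at ho
  rcases ho with ⟨hn, -⟩ | ⟨x, hx, ho⟩
  · exact absurd hn (none_notMem_of_forall hF)
  · obtain ⟨F', hF', hx'⟩ := hG x hx
    rw [Prog.eval_eq_of_le (hF'.trans (le_max_right F G)) (none_notMem_of_forall hx')] at ho
    exact hx' o ho

theorem Prog.Total.ite {a : ℕ} {p q : Prog} {s : MState} {Q : MState → Prop}
    (h0 : s.reg a = 0 → q.Total (s.tick (1 + (s.reg a).size)) Q)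
    (h1 : s.reg a ≠ 0 → p.Total (s.tick (1 + (s.reg a).size)) Q) :
    (Prog.ite a p q).Total s Q := by
  by_cases h : s.reg a = 0
  · obtain ⟨F, hF⟩ := h0 h
    exact ⟨F, by rwa [Prog.eval, if_pos h]⟩
  · obtain ⟨F, hF⟩ := h1 h
    exact ⟨F, by rwa [Prog.eval, if_neg h]⟩

theorem Prog.Total.const {d c : ℕ} {s : MState} {Q : MState → Prop}
    (h : Q (s.write d c (1 + c.size))) : (Prog.const d c).Total s Q :=
  ⟨0, fun o ho => by
    rw [Prog.eval, PMF.support_pure, Set.mem_singleton_iff] at ho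
    exact ⟨_, ho, h⟩⟩

theorem Prog.Total.arith {op : ArithOp} {d a b : ℕ} {s : MState} {Q : MState → Prop}
    (h : Q (s.write d (op.apply (s.reg a) (s.reg b)) (1 + (s.reg a).size + (s.reg b).size))) :
    (Prog.arith op d a b).Total s Q :=
  ⟨0, fun o ho => by
    rw [Prog.eval, PMF.support_pure, Set.mem_singleton_iff] at ho
    exact ⟨_, ho, h⟩⟩

theorem Prog.Total.flip {d : ℕ} {s : MState} {Q : MState → Prop}
    (h : ∀ b : Bool, Q (s.write d b.toNat 1)) : (Prog.flip d).Total s Q :=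
  ⟨0, fun o ho => by
    rw [Prog.eval, PMF.mem_support_bind_iff] at ho
    obtain ⟨b, -, ho⟩ := ho
    rw [PMF.support_pure, Set.mem_singleton_iff] at ho
    exact ⟨_, ho, h b⟩⟩

theorem Prog.Total.loop_step {a : ℕ} {p : Prog} {s : MState} {Q : MState → Prop}
    (h1 : s.reg a ≠ 0)
    (h : p.Total (s.tick (1 + (s.reg a).size)) fun s' => (Prog.loop a p).Total s' Q) :
    (Prog.loop a p).Total s Q := by
  obtain ⟨F, hF⟩ := h
  obtain ⟨G, hG⟩ := exists_fuel (p.finite_support_eval F _)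
    (R := fun s' F => ∀ o ∈ ((Prog.loop a p).eval F s').support, ∃ t, o = some t ∧ Q t) (by
      intro s' hs'
      obtain ⟨t, ht, hQ⟩ := hF _ hs'
      cases ht
      exact hQ)
  -- The additional unit pays for the loop test already made.
  refine ⟨max F G + 1, fun o ho => ?_⟩
  rw [Prog.eval, iterLoop, if_neg h1,
    Prog.eval_eq_of_le (by omega : F ≤ max F G + 1) (none_notMem_of_forall hF),
    mem_support_andThen] at ho
  rcases ho with ⟨hn, -⟩ | ⟨x, hx, ho⟩
  · exact absurd hn (none_notMem_of_forall hF)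
  · obtain ⟨F', hF', hx'⟩ := hG x hx
    have hF'' : F' ≤ max F G := hF'.trans (le_max_right F G)
    rw [pmf_eq_of_some_le (m := (Prog.loop a p).eval F' x) (none_notMem_of_forall hx')
      (iterLoop_mono (p.eval_mono (by omega)) hF'' x)] at ho
    exact hx' o ho

/-- The rule for loops: `I k` holds before the loop test when `k` more iterations are due. -/
theorem Prog.Total.loop {a : ℕ} {p : Prog} {Q : MState → Prop} (I : ℕ → MState → Prop)
    (hdone : ∀ s, I 0 s → s.reg a = 0 ∧ Q (s.tick (1 + (s.reg a).size)))
    (hstep : ∀ k s, I (k + 1) s →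
      s.reg a ≠ 0 ∧ p.Total (s.tick (1 + (s.reg a).size)) (I k)) :
    ∀ k s, I k s → (Prog.loop a p).Total s Q
  | 0, s, h => ⟨1, fun o ho => by
      rw [Prog.eval, iterLoop, if_pos (hdone s h).1, PMF.support_pure,
        Set.mem_singleton_iff] at ho
      exact ⟨_, ho, (hdone s h).2⟩⟩
  | k + 1, s, h => loop_step (hstep k s h).1
      ((hstep k s h).2.mono fun s' hs' => Prog.Total.loop I hdone hstep k s' hs')

/-! ### Registers that a program does not use -/

/-- All registers named in the program satisfy `P`. -/
def Prog.RegsIn (P : ℕ → Prop) : Prog → Prop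
  | .const d _ => P d
  | .arith _ d a b => P d ∧ P a ∧ P b
  | .flip d => P d
  | .seq p q => p.RegsIn P ∧ q.RegsIn P
  | .ite a p q => P a ∧ p.RegsIn P ∧ q.RegsIn P
  | .loop a p => P a ∧ p.RegsIn P

theorem Prog.RegsIn.mono {P P' : ℕ → Prop} (h : ∀ i, P i → P' i) {p : Prog} (hp : p.RegsIn P) :
    p.RegsIn P' := by
  induction p <;> simp_all [Prog.RegsIn]

theorem Prog.regsIn_true (p : Prog) : p.RegsIn fun _ => True := by
  induction p <;> simp_all [Prog.RegsIn]

theorem Prog.exists_regsIn (p : Prog) : ∃ M, p.RegsIn (· < M) := by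
  induction p with
  | const d c => exact ⟨d + 1, Nat.lt_succ_self d⟩
  | arith op d a b => exact ⟨d + a + b + 1, by simp only [Prog.RegsIn]; omega⟩
  | flip d => exact ⟨d + 1, Nat.lt_succ_self d⟩
  | seq p q hp hq =>
    obtain ⟨M, hM⟩ := hp
    obtain ⟨N, hN⟩ := hq
    exact ⟨M + N, hM.mono (by intros; omega), hN.mono (by intros; omega)⟩
  | ite a p q hp hq =>
    obtain ⟨M, hM⟩ := hp
    obtain ⟨N, hN⟩ := hq
    exact ⟨M + N + a + 1, by omega, hM.mono (by intros; omega), hN.mono (by intros; omega)⟩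
  | loop a p hp =>
    obtain ⟨M, hM⟩ := hp
    exact ⟨M + a + 1, by omega, hM.mono (by intros; omega)⟩

open scoped Classical in
/-- Replace the contents of the registers outside `P` by those of `g`. -/
noncomputable def overlay (P : ℕ → Prop) (g r : ℕ → ℕ) : ℕ → ℕ := fun i => if P i then r i else g i

theorem overlay_true (g r : ℕ → ℕ) : overlay (fun _ => True) g r = r :=
  funext fun _ => if_pos trivial

/-- Change the registers outside `P`, and advance the clock. -/
noncomputable def MState.overlay (P : ℕ → Prop) (g : ℕ → ℕ) (t : ℕ) (s : MState) : MState :=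
  ⟨HOPE.overlay P g s.reg, s.clock + t⟩

theorem MState.overlay_tick (P : ℕ → Prop) (g : ℕ → ℕ) (t u : ℕ) (s : MState) :
    (s.overlay P g t).tick u = (s.tick u).overlay P g t := by
  simp only [MState.overlay, MState.tick, MState.mk.injEq, true_and]
  omega

theorem MState.overlay_write {P : ℕ → Prop} {d : ℕ} (hd : P d) (g : ℕ → ℕ) (t v u : ℕ)
    (s : MState) : (s.overlay P g t).write d v u = (s.write d v u).overlay P g t := by
  simp only [MState.overlay, MState.write, MState.mk.injEq]
  refine ⟨?_, by omega⟩
  funext i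
  by_cases hi : i = d
  · subst hi; simp [HOPE.overlay, hd]
  · simp [HOPE.overlay, Function.update_of_ne hi]

theorem MState.overlay_reg {P : ℕ → Prop} {i : ℕ} (hi : P i) (g : ℕ → ℕ) (t : ℕ) (s : MState) :
    (s.overlay P g t).reg i = s.reg i := if_pos hi

theorem iterLoop_overlay {P : ℕ → Prop} {a : ℕ} (ha : P a) (g : ℕ → ℕ) (t : ℕ)
    {b : MState → PMF (Option MState)}
    (hb : ∀ s, b (s.overlay P g t) = (b s).map (Option.map (MState.overlay P g t))) (c : ℕ) :
    ∀ s, iterLoop a b c (s.overlay P g t) =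
      (iterLoop a b c s).map (Option.map (MState.overlay P g t)) := by
  induction c with
  | zero => intro s; simp [iterLoop, PMF.pure_map]
  | succ c ih =>
    intro s
    rw [iterLoop, iterLoop, MState.overlay_reg ha, MState.overlay_tick]
    split_ifs
    · rw [PMF.pure_map]; rfl
    · rw [hb, map_andThen, andThen_map]
      simp only [ih]

/-- Two uses: with `P` the registers below the scratch area, `A` runs inside the distinguisher as it
does alone; with `P` always true, only the clock is shifted, so the outcome does not depend on it.
-/
theorem Prog.eval_overlay {P : ℕ → Prop} (F : ℕ) (g : ℕ → ℕ) (t : ℕ) {p : Prog}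
    (hp : p.RegsIn P) : ∀ s, p.eval F (s.overlay P g t) =
      (p.eval F s).map (Option.map (MState.overlay P g t)) := by
  induction p with
  | const d c => intro s; rw [Prog.eval, Prog.eval, MState.overlay_write hp, PMF.pure_map]; rfl
  | arith op d a b =>
    intro s
    rw [Prog.eval, Prog.eval, MState.overlay_write hp.1, MState.overlay_reg hp.2.1,
      MState.overlay_reg hp.2.2, PMF.pure_map]
    rfl
  | flip d =>
    intro s
    simp only [Prog.eval, MState.overlay_write (show P d from hp), PMF.map_bind, PMF.pure_map]
    rfl
  | seq p q ihp ihq =>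
    intro s
    rw [Prog.eval, Prog.eval, ihp hp.1, map_andThen, andThen_map]
    simp only [ihq hp.2]
  | ite a p q ihp ihq =>
    intro s
    rw [Prog.eval, Prog.eval, MState.overlay_reg hp.1, MState.overlay_tick]
    split_ifs
    · exact ihq hp.2.2 _
    · exact ihp hp.2.1 _
  | loop a p ihp => exact iterLoop_overlay hp.1 g t (ihp hp.2) F

theorem Prog.Total.overlay {P : ℕ → Prop} {p : Prog} (hp : p.RegsIn P) {g : ℕ → ℕ} {t : ℕ}
    {s : MState} {Q : MState → Prop} (h : p.Total s fun s' => Q (s'.overlay P g t)) :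
    p.Total (s.overlay P g t) Q := by
  obtain ⟨F, hF⟩ := h
  refine ⟨F, fun o ho => ?_⟩
  rw [Prog.eval_overlay F g t hp, PMF.support_map] at ho
  obtain ⟨o', ho', rfl⟩ := ho
  obtain ⟨s', rfl, hs'⟩ := hF o' ho'
  exact ⟨_, rfl, hs'⟩

/-! ### Expectations over the coins -/

/-- The expectation of a function of the final registers; unfinished runs count `0`. -/
noncomputable def expReg (m : PMF (Option MState)) (f : (ℕ → ℕ) → ℝ≥0∞) : ℝ≥0∞ :=
  ∑' s : MState, m (some s) * f s.reg

theorem expReg_pure (s : MState) (f : (ℕ → ℕ) → ℝ≥0∞) :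
    expReg (PMF.pure (some s)) f = f s.reg := by
  rw [expReg, tsum_eq_single s]
  · simp [PMF.pure_apply]
  · intro t ht
    simp [PMF.pure_apply, ht]

theorem expReg_pure_none (f : (ℕ → ℕ) → ℝ≥0∞) : expReg (PMF.pure none) f = 0 := by
  simp [expReg, PMF.pure_apply]

theorem expReg_andThen {α : Type} (m : PMF (Option α)) (k : α → PMF (Option MState))
    (f : (ℕ → ℕ) → ℝ≥0∞) :
    expReg (andThen m k) f = ∑' x, m (some x) * expReg (k x) f := by
  simp only [expReg, andThen_apply_some, ← ENNReal.tsum_mul_right, ← ENNReal.tsum_mul_left]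
  rw [ENNReal.tsum_comm]
  simp only [mul_assoc]

theorem expReg_map {α : Type} (m : PMF (Option α)) (g : α → MState) (f : (ℕ → ℕ) → ℝ≥0∞) :
    expReg (m.map (Option.map g)) f = ∑' x, m (some x) * f (g x).reg := by
  have h : m.map (Option.map g) = andThen m fun x => PMF.pure (some (g x)) := by
    rw [andThen, PMF.map]
    congr 1
    funext o
    cases o <;> rfl
  rw [h, expReg_andThen]
  simp only [expReg_pure]

theorem expReg_mono {m m' : PMF (Option MState)} {f f' : (ℕ → ℕ) → ℝ≥0∞}
    (hm : ∀ s, m (some s) ≤ m' (some s)) (hf : ∀ r, f r ≤ f' r) : expReg m f ≤ expReg m' f' :=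
  ENNReal.tsum_le_tsum fun s => mul_le_mul' (hm s) (hf _)

/-- Monotone convergence for the counting measure. -/
theorem tsum_iSup_of_monotone {α : Type} {f : ℕ → α → ℝ≥0∞} (hf : Monotone f) :
    ∑' a, ⨆ n, f n a = ⨆ n, ∑' a, f n a := by
  let _ : MeasurableSpace α := ⊤
  simp only [← MeasureTheory.lintegral_count]
  exact MeasureTheory.lintegral_iSup (fun _ => measurable_from_top) hf

theorem expReg_iSup (m : PMF (Option MState)) {f : ℕ → (ℕ → ℕ) → ℝ≥0∞} (hf : Monotone f) :
    expReg m (fun r => ⨆ n, f n r) = ⨆ n, expReg m (f n) := by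
  simp only [expReg, ENNReal.mul_iSup]
  exact tsum_iSup_of_monotone fun i j hij s => mul_le_mul' le_rfl (hf hij _)

theorem MState.overlay_true_eq (s : MState) :
    (⟨s.reg, 0⟩ : MState).overlay (fun _ => True) s.reg s.clock = s := by
  rw [MState.overlay, overlay_true, Nat.zero_add]

theorem expReg_overlay_true (m : PMF (Option MState)) (g : ℕ → ℕ) (t : ℕ)
    (f : (ℕ → ℕ) → ℝ≥0∞) :
    expReg (m.map (Option.map (MState.overlay (fun _ => True) g t))) f = expReg m f := by
  rw [expReg_map]
  simp only [MState.overlay, overlay_true]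
  rfl

theorem expReg_eval (F : ℕ) (p : Prog) (s : MState) (f : (ℕ → ℕ) → ℝ≥0∞) :
    expReg (p.eval F s) f = expReg (p.eval F ⟨s.reg, 0⟩) f := by
  conv_lhs => rw [← s.overlay_true_eq]
  rw [Prog.eval_overlay F _ _ p.regsIn_true, expReg_overlay_true]

theorem expReg_iterLoop (F a : ℕ) (p : Prog) (c : ℕ) (s : MState) (f : (ℕ → ℕ) → ℝ≥0∞) :
    expReg (iterLoop a (p.eval F) c s) f = expReg (iterLoop a (p.eval F) c ⟨s.reg, 0⟩) f := by
  conv_lhs => rw [← s.overlay_true_eq]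
  rw [iterLoop_overlay (P := fun _ => True) trivial _ _ (Prog.eval_overlay F _ _ p.regsIn_true),
    expReg_overlay_true]

/-- The expectation of a function of the final registers, when the program is started with
registers `r`. -/
noncomputable def Prog.exp (p : Prog) (f : (ℕ → ℕ) → ℝ≥0∞) (r : ℕ → ℕ) : ℝ≥0∞ :=
  ⨆ F : ℕ, expReg (p.eval F ⟨r, 0⟩) f

theorem Prog.exp_const (d c : ℕ) (f : (ℕ → ℕ) → ℝ≥0∞) (r : ℕ → ℕ) :
    (Prog.const d c).exp f r = f (Function.update r d c) := by
  simp only [Prog.exp, Prog.eval, expReg_pure, ciSup_const, MState.write]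

theorem Prog.exp_arith (op : ArithOp) (d a b : ℕ) (f : (ℕ → ℕ) → ℝ≥0∞) (r : ℕ → ℕ) :
    (Prog.arith op d a b).exp f r = f (Function.update r d (op.apply (r a) (r b))) := by
  simp only [Prog.exp, Prog.eval, expReg_pure, ciSup_const, MState.write]

theorem Prog.exp_flip (d : ℕ) (f : (ℕ → ℕ) → ℝ≥0∞) (r : ℕ → ℕ) :
    (Prog.flip d).exp f r = 2⁻¹ * (f (Function.update r d 0) + f (Function.update r d 1)) := by
  have h : ∀ F, (Prog.flip d).eval F ⟨r, 0⟩ =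
      andThen ((PMF.uniformOfFintype Bool).map some) fun b =>
        PMF.pure (some ((⟨r, 0⟩ : MState).write d b.toNat 1)) := by
    intro F
    rw [andThen, PMF.bind_map]
    rfl
  simp only [Prog.exp, h, ciSup_const]
  rw [expReg_andThen]
  have h' : ∀ b : Bool, ((PMF.uniformOfFintype Bool).map some) (some b) = 2⁻¹ := by
    intro b
    rw [PMF.map_apply, tsum_eq_single b]
    · simp
    · intro b' hb'
      simp [hb'.symm]
  simp only [h', expReg_pure, tsum_fintype, Fintype.sum_bool, MState.write, Bool.toNat_true,
    Bool.toNat_false]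
  ring

theorem Prog.exp_ite (a : ℕ) (p q : Prog) (f : (ℕ → ℕ) → ℝ≥0∞) (r : ℕ → ℕ) :
    (Prog.ite a p q).exp f r = if r a = 0 then q.exp f r else p.exp f r := by
  split_ifs with h
  · simp only [Prog.exp, Prog.eval, if_pos h]
    exact iSup_congr fun F => expReg_eval _ _ _ _
  · simp only [Prog.exp, Prog.eval, if_neg h]
    exact iSup_congr fun F => expReg_eval _ _ _ _

theorem Prog.monotone_expReg (p : Prog) (f : (ℕ → ℕ) → ℝ≥0∞) :
    Monotone fun F r => expReg (p.eval F ⟨r, 0⟩) f :=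
  fun _ _ h _ => expReg_mono (p.eval_mono h _) fun _ => le_rfl

/-- Monotonicity in both indices reduces a double supremum to its diagonal. This is needed because
`Prog.eval` gives the same fuel to all parts of a program. -/
theorem Prog.exp_iSup (p : Prog) {f : ℕ → (ℕ → ℕ) → ℝ≥0∞} (hf : Monotone f) (r : ℕ → ℕ) :
    p.exp (fun r => ⨆ n, f n r) r = ⨆ n, expReg (p.eval n ⟨r, 0⟩) (f n) := by
  simp only [Prog.exp, expReg_iSup _ hf]
  refine le_antisymm (iSup_le fun i => iSup_le fun j => ?_)
    (iSup_le fun n => le_iSup_of_le n (le_iSup_of_le n le_rfl))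
  exact le_iSup_of_le (max i j)
    (expReg_mono (p.eval_mono (le_max_left i j) _) (hf (le_max_right i j)))

theorem Prog.exp_seq (p q : Prog) (f : (ℕ → ℕ) → ℝ≥0∞) (r : ℕ → ℕ) :
    (Prog.seq p q).exp f r = p.exp (q.exp f) r := by
  have := p.exp_iSup (q.monotone_expReg f) r
  rw [show p.exp (q.exp f) r = _ from this]
  refine iSup_congr fun F => ?_
  rw [Prog.eval, expReg_andThen]
  exact tsum_congr fun x => by rw [expReg_eval]

theorem Prog.exp_loop (a : ℕ) (p : Prog) (f : (ℕ → ℕ) → ℝ≥0∞) (r : ℕ → ℕ) :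
    (Prog.loop a p).exp f r = if r a = 0 then f r else p.exp ((Prog.loop a p).exp f) r := by
  have hstep : ∀ b c r, expReg (iterLoop a (p.eval b) (c + 1) ⟨r, 0⟩) f =
      if r a = 0 then f r else
        expReg (p.eval b ⟨r, 0⟩) fun r => expReg (iterLoop a (p.eval b) c ⟨r, 0⟩) f := by
    intro b c r
    rw [iterLoop]
    split_ifs
    · rw [expReg_pure]; rfl
    · rw [expReg_andThen]
      simp only [fun x => expReg_iterLoop b a p c x f]
      exact expReg_eval b p _ fun r => expReg (iterLoop a (p.eval b) c ⟨r, 0⟩) f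
  have hmono := (Prog.loop a p).monotone_expReg f
  split_ifs with h
  · refine le_antisymm (iSup_le fun F => ?_) (le_iSup_of_le 1 ?_)
    · cases F with
      | zero => rw [Prog.eval, iterLoop, expReg_pure_none]; exact zero_le
      | succ F => rw [Prog.eval, hstep, if_pos h]
    · rw [Prog.eval, hstep, if_pos h]
  · have hs := p.exp_iSup hmono r
    rw [show p.exp ((Prog.loop a p).exp f) r = _ from hs]
    -- Unrolling consumes one test but leaves the fuel of the body unchanged, so the two sides match
    -- only up to a shift of the fuel by one, absorbed by the supremum.
    refine le_antisymm (iSup_le fun F => ?_) (iSup_le fun F => le_iSup_of_le (F + 1) ?_)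
    · cases F with
      | zero => rw [Prog.eval, iterLoop, expReg_pure_none]; exact zero_le
      | succ F =>
        rw [Prog.eval, hstep, if_neg h]
        exact le_iSup_of_le (F + 1) (expReg_mono (fun _ => le_rfl) fun r =>
          expReg_mono (iterLoop_mono (fun _ _ => le_rfl) F.le_succ _) fun _ => le_rfl)
    · rw [Prog.eval, hstep, if_neg h]
      exact expReg_mono (p.eval_mono F.le_succ _) fun r =>
        expReg_mono (iterLoop_mono (p.eval_mono F.le_succ) le_rfl _) fun _ => le_rfl

theorem Prog.exp_overlay {P : ℕ → Prop} {p : Prog} (hp : p.RegsIn P) (g r : ℕ → ℕ)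
    (f : (ℕ → ℕ) → ℝ≥0∞) :
    p.exp f (overlay P g r) = p.exp (fun r => f (overlay P g r)) r := by
  refine iSup_congr fun F => ?_
  rw [show (⟨overlay P g r, 0⟩ : MState) = (⟨r, 0⟩ : MState).overlay P g 0 from rfl,
    Prog.eval_overlay F g 0 hp, expReg_map]
  rfl

/-- Output probabilities as expectations. -/
theorem Prog.exp_reg_zero (A : Prog) (κ : ℕ) (xs : List ℕ) (g : ℕ → ℝ≥0∞) :
    A.exp (fun r => g (r 0)) (initState κ xs).reg = ∑' y, A.outputProb κ xs y * g y := by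
  have h : ∀ F y, (A.eval F (initState κ xs)).map (Option.map fun s => s.reg 0) (some y) =
      ∑' s, A.eval F (initState κ xs) (some s) * if y = s.reg 0 then 1 else 0 := by
    intro F y
    rw [PMF.map_apply]
    refine ((Option.some_injective MState).tsum_eq ?_).symm.trans (tsum_congr fun s => ?_)
    · rintro (_ | x) hx
      · simp at hx
      · exact ⟨x, rfl⟩
    · simp
  simp only [Prog.outputProb, ENNReal.iSup_mul]
  rw [tsum_iSup_of_monotone]
  · refine iSup_congr fun F => ?_
    simp only [h, ← ENNReal.tsum_mul_right]
    rw [ENNReal.tsum_comm]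
    refine tsum_congr fun s => ?_
    rw [tsum_eq_single (s.reg 0)]
    · simp; rfl
    · intro y hy
      simp [hy]
  · intro F F' hF y
    simp only [h]
    exact mul_le_mul' (ENNReal.tsum_le_tsum fun s => mul_le_mul' (A.eval_mono hF _ _) le_rfl)
      le_rfl

theorem Prog.outputProb_eq_exp (A : Prog) (κ : ℕ) (xs : List ℕ) (y : ℕ) :
    A.outputProb κ xs y =
      A.exp (fun r => if r 0 = y then 1 else 0) (initState κ xs).reg := by
  rw [A.exp_reg_zero κ xs fun z => if z = y then 1 else 0, tsum_eq_single y]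
  · simp
  · intro z hz
    simp [hz]

theorem size_div_two (n : ℕ) : (n / 2).size = n.size - 1 := by
  refine le_antisymm ?_ ?_
  · rw [Nat.size_le]
    rcases Nat.eq_zero_or_pos n with rfl | hn
    · simp
    · have h := Nat.lt_size_self n
      have hs : 0 < n.size := Nat.size_pos.2 hn
      rw [show n.size = n.size - 1 + 1 by omega, pow_succ] at h
      omega
  · have : n.size ≤ (n / 2).size + 1 := by
      rw [Nat.size_le, pow_succ]
      have := Nat.lt_size_self (n / 2)
      omega
    omega

/-! ### Sampling a number with a given number of bits -/

/-- Append to the binary expansion of `R_d` as many random bits as `R_{M+6}` has. -/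
def sampleLoop (M d : ℕ) : Prog :=
  .loop (M + 6) <| .seq (.const (M + 7) 2) <| .seq (.arith .div (M + 6) (M + 6) (M + 7)) <|
    .seq (.flip (M + 7)) <| .seq (.arith .add d d d) (.arith .add d d (M + 7))

/-- Append to the binary expansion of `R_d` as many random bits as `R_{M+5}` has. -/
def sample (M d : ℕ) : Prog :=
  .seq (.const (M + 7) 0) <| .seq (.arith .add (M + 6) (M + 5) (M + 7)) <|
    .seq (sampleLoop M d) (.const (M + 7) 0)

/-- Each round fixes the next lower bit, so the range of length `2 ^ (L + 1)` splits into two halves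
according to the first coin. The last coin stays behind in `R_{M+7}`; hence only postconditions that
clear this register are considered. -/
theorem exp_sampleLoop {M d : ℕ} (h6 : d ≠ M + 6) (h7 : d ≠ M + 7) (f : (ℕ → ℕ) → ℝ≥0∞) :
    ∀ (L : ℕ) (r : ℕ → ℕ), (r (M + 6)).size = L →
      (sampleLoop M d).exp (fun r => f (Function.update r (M + 7) 0)) r =
        (2 ^ L)⁻¹ * ∑ c ∈ Finset.range (2 ^ L),
          f (Function.update (Function.update (Function.update r d (r d * 2 ^ L + c))
            (M + 6) 0) (M + 7) 0) := by
  intro L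
  induction L with
  | zero =>
    intro r hr
    rw [Nat.size_eq_zero] at hr
    rw [sampleLoop, Prog.exp_loop, if_pos hr]
    simp only [pow_zero, inv_one, one_mul, mul_one, Finset.range_one, Finset.sum_singleton,
      add_zero, Function.update_eq_self]
    rw [← hr, Function.update_eq_self]
  | succ L ih =>
    intro r hr
    have h0 : r (M + 6) ≠ 0 := by
      intro h
      rw [h] at hr
      simp at hr
    have key : ∀ b : ℕ, (sampleLoop M d).exp (fun r => f (Function.update r (M + 7) 0))
        (Function.update (Function.update (Function.update (Function.update (Function.update r
          (M + 7) 2) (M + 6) (r (M + 6) / 2)) (M + 7) b) d (r d + r d)) d (r d + r d + b)) =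
        (2 ^ L)⁻¹ * ∑ c ∈ Finset.range (2 ^ L),
          f (Function.update (Function.update (Function.update r d
            (r d * 2 ^ (L + 1) + (2 ^ L * b + c))) (M + 6) 0) (M + 7) 0) := by
      intro b
      rw [ih _ (by simp [h6.symm, size_div_two, hr])]
      congr 1
      refine Finset.sum_congr rfl fun c _ => ?_
      congr 1
      funext i
      simp only [Function.update_apply]
      split_ifs <;> first | rfl | omega | ring
    rw [sampleLoop, Prog.exp_loop, if_neg h0, ← sampleLoop]
    simp only [Prog.exp_seq, Prog.exp_const, Prog.exp_arith, Prog.exp_flip, ArithOp.apply]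
    have e1 := key 0
    have e2 := key 1
    simp only [Nat.add_zero] at e1
    simp [h6, h7, h7.symm, Function.update_of_ne] at e1 e2 ⊢
    rw [e1, e2, ← mul_add, ← mul_assoc, pow_succ 2 L, Nat.mul_two, Finset.sum_range_add]
    congr 1
    rw [pow_succ, ENNReal.mul_inv (by simp) (by simp), mul_comm]

theorem exp_sample {M d : ℕ} (h6 : d ≠ M + 6) (h7 : d ≠ M + 7)
    (f : (ℕ → ℕ) → ℝ≥0∞) (r : ℕ → ℕ) (hd : r d = 0) :
    (sample M d).exp f r = (2 ^ (r (M + 5)).size)⁻¹ *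
      ∑ c ∈ Finset.range (2 ^ (r (M + 5)).size),
        f (Function.update (Function.update (Function.update r d c) (M + 6) 0) (M + 7) 0) := by
  simp only [sample, Prog.exp_seq, Prog.exp_const, Prog.exp_arith, ArithOp.apply]
  rw [show (Prog.const (M + 7) 0).exp f = fun r => f (Function.update r (M + 7) 0) from
    funext (Prog.exp_const _ _ _)]
  rw [exp_sampleLoop h6 h7 f (r (M + 5)).size _ (by simp)]
  congr 1
  refine Finset.sum_congr rfl fun c _ => ?_
  congr 1
  funext i
  simp only [Function.update_apply]
  split_ifs <;> first | rfl | omega | (rw [hd]; ring)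

/-! ### Modular exponentiation -/

/-- `R_{M+6} := R_{M+6} · R_{M+4} ^ R_0 mod R_{M+5}`, by repeated squaring. -/
def powLoop (M : ℕ) : Prog :=
  .loop 0 <| .seq (.const (M + 7) 2) <| .seq (.arith .mod (M + 8) 0 (M + 7)) <|
    .seq (.arith .div 0 0 (M + 7)) <|
    .seq (.ite (M + 8) (.seq (.arith .mul (M + 6) (M + 6) (M + 4))
      (.arith .mod (M + 6) (M + 6) (M + 5))) (.const (M + 7) 0)) <|
    .seq (.arith .mul (M + 4) (M + 4) (M + 4)) (.arith .mod (M + 4) (M + 4) (M + 5))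

/-- The value `R_{M+6} · R_{M+4} ^ R_0` modulo `R_{M+5}` is invariant, by `x ^ e = x ^ (e % 2) * (x
* x) ^ (e / 2)`. -/
theorem exp_powLoop (M : ℕ) (g : ℕ → ℝ≥0∞) (e : ℕ) : ∀ r : ℕ → ℕ, r 0 = e →
    r (M + 6) < r (M + 5) → (powLoop M).exp (fun r => g (r (M + 6))) r =
      g (r (M + 6) * r (M + 4) ^ e % r (M + 5)) := by
  induction e using Nat.strong_induction_on with
  | _ e ih =>
    intro r hr hlt
    rw [powLoop, Prog.exp_loop, ← powLoop]
    split_ifs with h0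
    · rw [← hr, h0, pow_zero, mul_one, Nat.mod_eq_of_lt hlt]
    · have hpos : 0 < r (M + 5) := by omega
      simp only [Prog.exp_seq, Prog.exp_const, Prog.exp_arith, Prog.exp_ite, ArithOp.apply]
      have hdiv : e / 2 < e := by omega
      have hpow : ∀ x : ℕ, x ^ e = x ^ (e % 2) * (x * x) ^ (e / 2) := by
        intro x
        rw [← pow_two, ← pow_mul, ← pow_add, Nat.mod_add_div]
      split_ifs with hb
      · rw [ih (e / 2) hdiv _ (by simp [hr])
          (by simpa [Function.update_apply] using hlt)]
        simp only [Function.update_apply] at hb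
        simp [hr] at hb
        simp
        rw [hpow, hb, pow_zero, one_mul, Nat.mul_mod, ← Nat.pow_mod, ← Nat.mul_mod]
      · rw [ih (e / 2) hdiv _ (by simp [hr])
          (by simpa [Function.update_apply] using Nat.mod_lt _ hpos)]
        simp only [Function.update_apply] at hb
        simp [hr] at hb
        simp
        rw [hpow, hb, pow_one, ← Nat.mul_assoc, Nat.mul_mod, ← Nat.pow_mod, ← Nat.mul_mod]

/-! ### The distinguisher -/

/-- Test whether `R_{M+4} ^ R_0 ≤ 1` modulo the square of `R_{M+5}`. -/
def powTest (M : ℕ) : Prog :=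
  .seq (.arith .mul (M + 5) (M + 5) (M + 5)) <| .seq (.const (M + 6) 1) <|
    .seq (powLoop M) <| .seq (.const (M + 7) 1) <| .seq (.arith .sub 0 (M + 6) (M + 7)) <|
    .arith .sub 0 (M + 7) 0

theorem exp_powTest (M : ℕ) (r : ℕ → ℕ) (hr : 1 < r (M + 5)) :
    (powTest M).exp (fun r => if r 0 = 1 then 1 else 0) r =
      if r (M + 4) ^ r 0 % (r (M + 5) * r (M + 5)) ≤ 1 then 1 else 0 := by
  -- With truncated subtraction, `1 - (x - 1)` is the indicator of `x ≤ 1`.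
  have h01 : ∀ x : ℕ, (1 - (x - 1) = 1) = (x ≤ 1) := fun x => by
    rw [eq_iff_iff]; omega
  have htail : (Prog.seq (.const (M + 7) 1) <| .seq (.arith .sub 0 (M + 6) (M + 7)) <|
      .arith .sub 0 (M + 7) 0).exp (fun r => if r 0 = 1 then 1 else 0) =
      fun r => if r (M + 6) ≤ 1 then 1 else 0 := by
    funext r
    simp only [Prog.exp_seq, Prog.exp_const, Prog.exp_arith, ArithOp.apply]
    simp [h01]
  simp only [powTest, Prog.exp_seq, Prog.exp_const, Prog.exp_arith, ArithOp.apply] at htail ⊢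
  rw [htail, exp_powLoop M (fun x => if x ≤ 1 then 1 else 0) (r 0) _ (by simp)
    (by simpa using by nlinarith)]
  simp

/-- Move the input `n, h` to the registers `M + 5` and `M + 4`. -/
def moveInput (M : ℕ) : Prog :=
  .seq (.const (M + 7) 0) <| .seq (.arith .add (M + 4) 2 (M + 7)) <|
    .seq (.arith .add (M + 5) 1 (M + 7)) (.const 2 0)

/-- Run `A` on the modulus and a pair of random numbers, and test whether its output `s` satisfies
`h ^ s = 1` modulo `n²`. -/
def distinguisher (M : ℕ) (A : Prog) : Prog :=
  .ite 1 (.seq (moveInput M) <| .seq (sample M 2) <| .seq (sample M 3) <| .seq A (powTest M))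
    (.const 0 0)

/-- The contents of the scratch registers while `A` is running. -/
def scratch (M n h : ℕ) : ℕ → ℕ := fun i => if i = M + 4 then h else if i = M + 5 then n else 0

theorem exp_distinguisher {M : ℕ} {A : Prog} (hA : A.RegsIn (· < M + 4)) (κ n h : ℕ)
    (hn : 1 < n) :
    (distinguisher M A).outputProb κ [n, h] 1 =
      (2 ^ n.size)⁻¹ * ∑ c₀ ∈ Finset.range (2 ^ n.size),
        ((2 ^ n.size)⁻¹ * ∑ c₁ ∈ Finset.range (2 ^ n.size),
          ∑' s, A.outputProb κ [n, c₀, c₁] s * if h ^ s % (n * n) ≤ 1 then 1 else 0) := by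
  have key : ∀ c₀ c₁, A.exp ((powTest M).exp fun r => if r 0 = 1 then 1 else 0)
      (overlay (· < M + 4) (scratch M n h) (initState κ [n, c₀, c₁]).reg) =
      ∑' s, A.outputProb κ [n, c₀, c₁] s * if h ^ s % (n * n) ≤ 1 then 1 else 0 := by
    intro c₀ c₁
    rw [Prog.exp_overlay hA,
      ← A.exp_reg_zero κ [n, c₀, c₁] fun s => if h ^ s % (n * n) ≤ 1 then 1 else 0]
    congr 1
    funext r
    rw [exp_powTest]
    · simp [overlay, scratch]
    · simpa [overlay, scratch] using hn
  rw [Prog.outputProb_eq_exp, distinguisher, Prog.exp_ite, if_neg (by simp [initState]; omega)]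
  simp only [moveInput, Prog.exp_seq, Prog.exp_const, Prog.exp_arith, ArithOp.apply]
  rw [exp_sample (by omega) (by omega) _ _ (by simp)]
  have hreg : ∀ r : ℕ → ℕ, r (M + 5) = n → ∀ f g : ℕ → ℝ≥0∞, (∀ c, f c = g c) →
      (2 ^ (r (M + 5)).size)⁻¹ * ∑ c ∈ Finset.range (2 ^ (r (M + 5)).size), f c =
      (2 ^ n.size)⁻¹ * ∑ c ∈ Finset.range (2 ^ n.size), g c := by
    rintro r rfl f g h
    simp only [h]
  refine hreg _ (by simp [initState]) _ _ fun c₀ => ?_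
  rw [Prog.exp_seq, exp_sample (by omega) (by omega) _ _ (by simp [initState])]
  refine hreg _ (by simp [initState]) _ _ fun c₁ => ?_
  rw [Prog.exp_seq, ← key]
  congr 1
  funext i
  simp only [Function.update_apply, overlay, scratch, initState]
  rcases i with _ | _ | _ | _ | i <;> simp
  grind

/-! ### Running times -/

theorem size_two_mul_add_le {x b : ℕ} (hb : b ≤ 1) : (x + x + b).size ≤ x.size + 1 := by
  rw [Nat.size_le, pow_succ]
  have := Nat.lt_size_self x
  omega

theorem size_mul_le (x y : ℕ) : (x * y).size ≤ x.size + y.size := by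
  rw [Nat.size_le, pow_add]
  exact Nat.mul_lt_mul'' (Nat.lt_size_self x) (Nat.lt_size_self y)

theorem size_mod_le (x : ℕ) {m : ℕ} (hm : m ≠ 0) : (x % m).size ≤ m.size :=
  Nat.size_le_size (Nat.mod_lt _ (Nat.pos_of_ne_zero hm)).le

theorem size_le_self (n : ℕ) : n.size ≤ n := Nat.size_le.2 Nat.lt_two_pow_self

/-- The bound is exactly the charge for the instruction: no register can grow faster than the clock.
-/
theorem ArithOp.size_apply_le (op : ArithOp) (x y : ℕ) :
    (op.apply x y).size ≤ 1 + x.size + y.size := by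
  cases op with
  | add =>
    have h1 := Nat.lt_size_self x
    have h2 := Nat.lt_size_self y
    have h3 : 2 ^ x.size ≤ 2 ^ (x.size + y.size) := Nat.pow_le_pow_right (by norm_num) (by omega)
    have h4 : 2 ^ y.size ≤ 2 ^ (x.size + y.size) := Nat.pow_le_pow_right (by norm_num) (by omega)
    rw [ArithOp.apply, Nat.size_le, show 1 + x.size + y.size = x.size + y.size + 1 by omega,
      pow_succ]
    omega
  | sub => exact (Nat.size_le_size (Nat.sub_le x y)).trans (by omega)
  | mul => exact (size_mul_le x y).trans (by omega)
  | div => exact (Nat.size_le_size (Nat.div_le_self x y)).trans (by omega)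
  | mod => exact (Nat.size_le_size (Nat.mod_le x y)).trans (by omega)

/-- All registers have at most `B` bits more than the time spent. -/
def MState.SizeLe (B : ℕ) (s : MState) : Prop := ∀ i, (s.reg i).size ≤ B + s.clock

theorem MState.SizeLe.tick {B : ℕ} {s : MState} (h : s.SizeLe B) (t : ℕ) : (s.tick t).SizeLe B :=
  fun i => (h i).trans (by simp only [MState.tick]; omega)

theorem MState.SizeLe.write {B : ℕ} {s : MState} (h : s.SizeLe B) {d v t : ℕ} (hv : v.size ≤ t) :
    (s.write d v t).SizeLe B := by
  intro i
  have := h i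
  simp only [MState.write, Function.update_apply]
  split_ifs <;> omega

theorem Prog.sizeLe_of_mem_support {B F : ℕ} (p : Prog) : ∀ s : MState, s.SizeLe B →
    ∀ s', some s' ∈ (p.eval F s).support → s'.SizeLe B := by
  have hpure : ∀ s s' : MState, s.SizeLe B →
      some s' ∈ (PMF.pure (some s)).support → s'.SizeLe B := by
    intro s s' hs hs'
    rw [PMF.support_pure, Set.mem_singleton_iff, Option.some.injEq] at hs'
    exact hs' ▸ hs
  induction p with
  | const d c => intro s hs s' hs'; exact hpure _ _ (hs.write (by omega)) hs'
  | arith op d a b => intro s hs s' hs'; exact hpure _ _ (hs.write (op.size_apply_le _ _)) hs'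
  | flip d =>
    intro s hs s' hs'
    rw [Prog.eval, PMF.mem_support_bind_iff] at hs'
    obtain ⟨b, -, hs'⟩ := hs'
    exact hpure _ _ (hs.write (by cases b <;> simp)) hs'
  | seq p q hp hq =>
    intro s hs s' hs'
    rw [Prog.eval, mem_support_andThen] at hs'
    rcases hs' with ⟨-, h⟩ | ⟨x, hx, hs'⟩
    · cases h
    · exact hq x (hp s hs x hx) s' hs'
  | ite a p q hp hq =>
    intro s hs s' hs'
    rw [Prog.eval] at hs'
    split_ifs at hs'
    · exact hq _ (hs.tick _) s' hs'
    · exact hp _ (hs.tick _) s' hs'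
  | loop a p hp =>
    have : ∀ c s, s.SizeLe B →
        ∀ s', some s' ∈ (iterLoop a (p.eval F) c s).support → s'.SizeLe B := by
      intro c
      induction c with
      | zero => intro s _ s' hs'; simp [iterLoop, PMF.support_pure] at hs'
      | succ c ih =>
        intro s hs s' hs'
        rw [iterLoop] at hs'
        split_ifs at hs'
        · exact hpure _ _ (hs.tick _) hs'
        · rw [mem_support_andThen] at hs'
          rcases hs' with ⟨-, h⟩ | ⟨x, hx, hs'⟩
          · cases h
          · exact ih x (hp _ (hs.tick _) x hx) s' hs'
    exact this F

/-- The hypothesis on `A` bounds only its time; this also bounds the length of its output, which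
becomes the exponent of the test. -/
theorem Prog.Total.sizeLe {p : Prog} {s : MState} {Q : MState → Prop} {B : ℕ}
    (hs : s.SizeLe B) (h : p.Total s Q) : p.Total s fun s' => Q s' ∧ s'.SizeLe B := by
  obtain ⟨F, hF⟩ := h
  refine ⟨F, fun o ho => ?_⟩
  obtain ⟨s', rfl, hQ⟩ := hF o ho
  exact ⟨s', rfl, hQ, p.sizeLe_of_mem_support s hs s' ho⟩

theorem total_sampleLoop {M d : ℕ} (h6 : d ≠ M + 6) (h7 : d ≠ M + 7) {W K : ℕ} {r : ℕ → ℕ}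
    {Q : MState → Prop} (hQ : ∀ s : MState,
      (∀ i, i ≠ d → i ≠ M + 6 → i ≠ M + 7 → s.reg i = r i) → s.reg (M + 6) = 0 →
      (s.reg d).size ≤ W → s.clock ≤ K + 1 → Q s) (s : MState)
    (hr : ∀ i, i ≠ d → i ≠ M + 6 → i ≠ M + 7 → s.reg i = r i)
    (hd : (s.reg d).size + (s.reg (M + 6)).size ≤ W)
    (hc : s.clock + (s.reg (M + 6)).size * (20 + 5 * W) ≤ K) :
    (sampleLoop M d).Total s Q := by
  -- A round makes five long reads: the counter twice, the old value of `R_d` twice and its double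
  -- once. This is the term `5 * W`.
  refine Prog.Total.loop (fun k s => (s.reg (M + 6)).size = k ∧
    (∀ i, i ≠ d → i ≠ M + 6 → i ≠ M + 7 → s.reg i = r i) ∧ (s.reg d).size + k ≤ W ∧
    s.clock + k * (20 + 5 * W) ≤ K) ?_ ?_ _ s ⟨rfl, hr, hd, hc⟩
  · rintro s ⟨h1, h2, h3, h4⟩
    rw [Nat.size_eq_zero] at h1
    refine ⟨h1, hQ _ h2 h1 (by simpa [MState.tick] using h3) ?_⟩
    simp only [MState.tick, h1, Nat.size_zero]
    omega
  · rintro k s ⟨h1, h2, h3, h4⟩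
    refine ⟨fun h => by rw [h] at h1; simp at h1, ?_⟩
    refine .seq (.const (.seq (.arith (.seq (.flip fun b => .seq (.arith (.arith ?_)))))))
    have hb : b.toNat ≤ 1 := b.toNat_le
    have hbs : b.toNat.size ≤ 1 := (Nat.size_le_size hb).trans (by simp)
    have hs1 := size_two_mul_add_le (x := s.reg d) hb
    have hs0 := size_two_mul_add_le (x := s.reg d) (b := 0) (by omega)
    have h2s : Nat.size 2 = 2 := by decide
    simp [MState.write, MState.tick, ArithOp.apply, h6, h7, h6.symm, h7.symm, size_div_two, h1, h2s]
    refine ⟨?_, ?_, ?_⟩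
    · intro i hi1 hi2 hi3
      simp [hi1, hi2, hi3, h2]
    · omega
    · rw [Nat.add_mul] at h4
      rw [Nat.add_zero] at hs0
      omega

theorem total_sample {M d : ℕ} (h6 : d ≠ M + 6) (h7 : d ≠ M + 7) {s : MState}
    (hd : s.reg d = 0) {W : ℕ} (hW : (s.reg (M + 5)).size ≤ W) {Q : MState → Prop}
    (hQ : ∀ (s' : MState) (c : ℕ), c.size ≤ W →
      s'.reg = Function.update (Function.update (Function.update s.reg d c) (M + 6) 0) (M + 7) 0 →
      s'.clock ≤ s.clock + (W + 1) * (20 + 5 * W) → Q s') :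
    (sample M d).Total s Q := by
  refine .seq (.const (.seq (.arith (.seq ?_))))
  refine total_sampleLoop (W := W) (K := s.clock + 2 + W + W * (20 + 5 * W)) (r := s.reg) h6 h7
    ?_ _ ?_ ?_ ?_
  · intro s' h1 h2 h3 h4
    refine .const (hQ _ (s'.reg d) h3 ?_ ?_)
    · funext i
      simp only [MState.write, Function.update_apply]
      split_ifs with e7 e6 ed
      · rfl
      · rw [e6, h2]
      · rw [ed]
      · exact h1 i ed e6 e7
    · simp only [MState.write, Nat.size_zero, Nat.add_mul]
      omega
  · intro i h1 h2 h3
    simp [MState.write, h2, h3]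
  · simpa [MState.write, ArithOp.apply, h6, h7, hd] using hW
  · simp [MState.write, ArithOp.apply]
    have := Nat.mul_le_mul_right (20 + 5 * W) hW
    omega

theorem total_powLoop {M W K : ℕ} {Q : MState → Prop} (hQ : ∀ s : MState,
      s.reg 0 = 0 → (s.reg (M + 6)).size ≤ W → s.clock ≤ K + 1 → Q s) (s : MState)
    (h0 : (s.reg 0).size ≤ W) (h4 : (s.reg (M + 4)).size ≤ W) (h5 : (s.reg (M + 5)).size ≤ W)
    (h6 : (s.reg (M + 6)).size ≤ W) (hpos : s.reg (M + 5) ≠ 0)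
    (hc : s.clock + (s.reg 0).size * (20 + 13 * W) ≤ K) : (powLoop M).Total s Q := by
  -- The term `13 * W` counts the bits read in a round: the exponent three times, two products of
  -- `W`-bit numbers, and two reductions of a product of up to `2 * W` bits by a `W`-bit modulus.
  refine Prog.Total.loop (fun k s => (s.reg 0).size = k ∧ k ≤ W ∧ (s.reg (M + 4)).size ≤ W ∧
    (s.reg (M + 5)).size ≤ W ∧ (s.reg (M + 6)).size ≤ W ∧ s.reg (M + 5) ≠ 0 ∧
    s.clock + k * (20 + 13 * W) ≤ K) ?_ ?_ _ s ⟨rfl, h0, h4, h5, h6, hpos, hc⟩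
  · rintro s ⟨h1, -, -, -, h5, -, h7⟩
    rw [Nat.size_eq_zero] at h1
    refine ⟨h1, hQ _ h1 h5 ?_⟩
    simp only [MState.tick, h1, Nat.size_zero]
    omega
  · rintro k s ⟨h1, hk, h4, h5, h6, hpos, hc⟩
    refine ⟨fun h => by rw [h] at h1; simp at h1, ?_⟩
    have h2s : Nat.size 2 = 2 := by decide
    have hbit : (s.reg 0 % 2).size ≤ 1 := Nat.size_le.2 (by omega)
    have hx := size_mul_le (s.reg (M + 4)) (s.reg (M + 4))
    have ha := size_mul_le (s.reg (M + 6)) (s.reg (M + 4))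
    have hxm := size_mod_le (s.reg (M + 4) * s.reg (M + 4)) hpos
    have ham := size_mod_le (s.reg (M + 6) * s.reg (M + 4)) hpos
    rw [Nat.add_mul] at hc
    refine .seq (.const (.seq (.arith (.seq (.arith (.seq (.ite (fun _ => .const ?_)
      fun _ => .seq (.arith (.arith ?_)))))))))
    all_goals
      refine .seq (.arith (.arith ?_))
      simp [MState.write, MState.tick, ArithOp.apply, size_div_two, h1, h2s, hpos]
      omega

theorem total_powTest {M W : ℕ} {s : MState} {Q : MState → Prop} (hW : 1 ≤ W)
    (h0 : (s.reg 0).size ≤ W) (h4 : (s.reg (M + 4)).size ≤ W)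
    (h5 : 2 * (s.reg (M + 5)).size ≤ W) (hpos : s.reg (M + 5) ≠ 0)
    (hQ : ∀ s' : MState, s'.clock ≤ s.clock + (W + 1) * (20 + 13 * W) → Q s') :
    (powTest M).Total s Q := by
  have hs := size_mul_le (s.reg (M + 5)) (s.reg (M + 5))
  refine .seq (.arith (.seq (.const (.seq ?_))))
  refine total_powLoop (W := W) (K := s.clock + 3 + W + W * (20 + 13 * W))
    ?_ _ ?_ ?_ ?_ ?_ ?_ ?_
  · intro s' h1 h2 h3
    refine .seq (.const (.seq (.arith (.arith (hQ _ ?_)))))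
    have := Nat.size_le_size (Nat.sub_le (s'.reg (M + 6)) 1)
    simp [MState.write, ArithOp.apply]
    rw [Nat.add_mul]
    omega
  · simpa [MState.write] using h0
  · simpa [MState.write] using h4
  · simp [MState.write, ArithOp.apply]
    omega
  · simpa [MState.write] using hW
  · simpa [MState.write, ArithOp.apply] using hpos
  · have := Nat.mul_le_mul_right (20 + 13 * W) h0
    simp [MState.write]
    omega

theorem eval_le_eval (T : Polynomial ℕ) {x y : ℕ} (h : x ≤ y) : T.eval x ≤ T.eval y := by
  rw [Polynomial.eval_eq_sum, Polynomial.eval_eq_sum]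
  exact Finset.sum_le_sum fun i _ => Nat.mul_le_mul_left _ (Nat.pow_le_pow_left h i)

theorem isPPT_distinguisher {M : ℕ} {A : Prog} (hA : A.RegsIn (· < M + 4)) (h : IsPPT 3 A) :
    IsPPT 2 (distinguisher M A) := by
  obtain ⟨T, hT⟩ := h
  refine ⟨100 * (2 * .X + T.comp (3 * .X) + 2) ^ 2, fun κ xs hxs => ?_⟩
  obtain ⟨n, x, rfl⟩ : ∃ n x, xs = [n, x] := List.length_eq_two.1 hxs
  set l := inputLength κ [n, x] with hl
  obtain ⟨U, hU⟩ : ∃ U, U = T.eval (3 * l) := ⟨_, rfl⟩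
  have hP : (100 * (2 * .X + T.comp (3 * .X) + 2) ^ 2 : Polynomial ℕ).eval l =
      100 * (2 * l + U + 2) ^ 2 := by
    simp [hU, Polynomial.eval_comp]
  rw [hP]
  have hl' : l = κ + n.size + x.size := by simp [hl, inputLength]; omega
  clear_value l
  change (distinguisher M A).Total _ fun s => s.clock ≤ _
  -- `W` bounds all lengths in the final test: `n²` has at most `2 * l` bits and the output of `A`
  -- at most `l + U`.
  obtain ⟨W, hW⟩ : ∃ W, W = 2 * l + U + 1 := ⟨_, rfl⟩
  have hbound : 3 * l + U + 10 + 2 * ((W + 1) * (20 + 5 * W)) + (W + 1) * (20 + 13 * W) ≤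
      100 * (2 * l + U + 2) ^ 2 := by
    rw [show 2 * l + U + 2 = W + 1 by omega]
    nlinarith
  have hlW : (l + 1) * (20 + 5 * l) ≤ (W + 1) * (20 + 5 * W) :=
    Nat.mul_le_mul (by omega) (by omega)
  -- Polynomial time is demanded on all inputs. For `n = 0` reduction does nothing, as `x mod 0 =
  -- x`, and repeated squaring would blow up; the initial branch excludes this case.
  refine .ite (fun h0 => .const ?_) fun h0 => .seq ?_
  · simp only [initState, List.getD_cons_succ, List.getD_cons_zero] at h0
    subst h0
    simp [initState, MState.write, MState.tick]
    omega
  have hn : n ≠ 0 := by simpa [initState] using h0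
  refine .seq (.const (.seq (.arith (.seq (.arith (.const ?_))))))
  refine .seq (total_sample (W := l) (by omega) (by omega) (by simp [MState.write]) ?_ ?_)
  · simp [MState.write, MState.tick, initState, ArithOp.apply]
    omega
  intro s₀ c₀ hc₀ hs₀ ht₀
  refine .seq (total_sample (W := l) (by omega) (by omega)
    (by simp [hs₀, MState.write, MState.tick, initState]) ?_ ?_)
  · simp [hs₀, MState.write, MState.tick, initState, ArithOp.apply]
    omega
  intro s₁ c₁ hc₁ hs₁ ht₁
  have hs : s₁ = (initState κ [n, c₀, c₁]).overlay (· < M + 4) (scratch M n x) s₁.clock := by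
    ext i
    · rw [hs₁, hs₀]
      simp only [MState.write, MState.tick, MState.overlay, Function.update_apply, overlay,
        scratch, initState, ArithOp.apply]
      rcases i with _ | _ | _ | _ | i <;> simp
      grind
    · simp [MState.overlay, initState]
  have ht : s₁.clock ≤ 2 * l + 10 + 2 * ((W + 1) * (20 + 5 * W)) := by
    simp [MState.write, MState.tick, initState] at ht₀
    omega
  -- `κ` and `n` together contribute at most `l`, and each random number at most `l`.
  have hlen : inputLength κ [n, c₀, c₁] ≤ 3 * l := by simp [inputLength]; omega
  have hTU := hU ▸ eval_le_eval T hlen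
  have hinit : (initState κ [n, c₀, c₁]).SizeLe l := by
    intro i
    have := size_le_self κ
    rcases i with _ | _ | _ | _ | i <;> simp [initState] <;> omega
  rw [hs]
  refine .seq (.overlay hA (((show A.Total _ fun s => s.clock ≤ _ from
    hT κ [n, c₀, c₁] rfl).sizeLe hinit).mono ?_))
  rintro s₂ ⟨ht₂, hsz⟩
  have hs0 := hsz 0
  refine total_powTest (W := W) (by omega) ?_ ?_ ?_ ?_ fun s' hs' => ?_
  · simp [MState.overlay, overlay]
    omega
  · simp [MState.overlay, overlay, scratch]
    omega
  · simp [MState.overlay, overlay, scratch]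
    omega
  · simpa [MState.overlay, overlay, scratch] using hn
  · simp only [MState.overlay] at hs'
    omega

/-! ### Powers of residues and of non-residues -/

theorem Key.one_lt_n (k : Key) : 1 < k.n :=
  Nat.one_lt_mul_iff.2 ⟨k.p_prime.pos, k.q_prime.pos, Or.inl k.p_prime.one_lt⟩

theorem Key.pow_sk_eq_one_iff (k : Key) (h : (ZMod (k.n ^ 2))ˣ) :
    h ^ k.sk = 1 ↔ k.IsNthResidue h := by
  constructor
  · intro hh
    -- The order of `h` divides `φ(n)`, hence is prime to `n`, so raising to the power `n` is
    -- invertible on the cyclic group generated by `h`.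
    have hco : k.n.Coprime (orderOf h) :=
      (k.coprime_sk.coprime_dvd_left (orderOf_dvd_of_pow_eq_one hh)).symm
    obtain ⟨m, hm⟩ := exists_pow_eq_self_of_coprime hco
    exact ⟨h ^ m, by rw [← pow_mul, mul_comm, pow_mul, hm]⟩
  · rintro ⟨g, rfl⟩
    have h1 := Nat.totient_gcd_mul_totient_mul k.n k.n
    have h2 : Nat.totient (k.n ^ 2) = k.n * k.sk := by
      have h3 : 0 < Nat.totient k.n := Nat.totient_pos.2 (Nat.pos_of_neZero _)
      rw [Nat.gcd_self, mul_assoc, ← pow_two] at h1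
      rw [Nat.eq_of_mul_eq_mul_left h3 h1, Key.sk, mul_comm]
    rw [← pow_mul, ← h2, ZMod.pow_totient]

/-- This is `[S : S ⊓ R] ≤ [G : R]` with denominators cleared. -/
theorem card_mul_card_le_card_inf_mul_card {G : Type*} [Group G] [Finite G] (R S : Subgroup G) :
    Nat.card S * Nat.card R ≤ Nat.card (S ⊓ R : Subgroup G) * Nat.card G := by
  have h1 := Subgroup.relIndex_mul_relIndex ⊥ (S ⊓ R) S bot_le inf_le_left
  rw [Subgroup.inf_relIndex_left, Subgroup.relIndex_bot_left, Subgroup.relIndex_bot_left] at h1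
  have h3 : R.relIndex S ≤ R.index := by
    rw [← Subgroup.relIndex_top_right]
    exact Subgroup.relIndex_le_of_le_right le_top (by simpa using Subgroup.index_ne_zero_of_finite)
  rw [← h1, ← R.index_mul_card, mul_assoc]
  exact Nat.mul_le_mul_left _ (Nat.mul_le_mul_right _ h3)

theorem tsum_uniformOfFintype_ite {α : Type} [Fintype α] [Nonempty α] (P : α → Prop)
    [DecidablePred P] :
    ∑' a, PMF.uniformOfFintype α a * (if P a then 1 else 0) =
      (Nat.card {a // P a} : ℝ≥0∞) / Nat.card α := by
  simp only [PMF.uniformOfFintype_apply, tsum_fintype, ← Finset.mul_sum, Finset.sum_boole,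
    Nat.card_eq_fintype_card, Fintype.card_subtype]
  rw [mul_comm, ENNReal.div_eq_inv_mul, mul_comm]

theorem Key.prob_pow_eq_one_le (k : Key) (s : ℕ) :
    (∑' h, k.randomNonresidue h * if h.1 ^ s = 1 then 1 else 0) ≤
      ∑' h, k.randomResidue h * if h.1 ^ s = 1 then 1 else 0 := by
  classical
  have e : ∀ p : (ZMod (k.n ^ 2))ˣ → Prop,
      Nat.card {h : {h : (ZMod (k.n ^ 2))ˣ // p h} // h.1 ^ s = 1} =
      {h : (ZMod (k.n ^ 2))ˣ | p h ∧ h ^ s = 1}.ncard := fun p =>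
    Nat.card_congr (Equiv.subtypeSubtypeEquivSubtypeInter p fun h => h ^ s = 1)
  rw [Key.randomNonresidue, Key.randomResidue, tsum_uniformOfFintype_ite,
    tsum_uniformOfFintype_ite, e, e]
  have hcard := card_mul_card_le_card_inf_mul_card
    (powMonoidHom k.n : (ZMod (k.n ^ 2))ˣ →* _).range (powMonoidHom s).ker
  set a := {h : (ZMod (k.n ^ 2))ˣ | k.IsNthResidue h ∧ h ^ s = 1}.ncard with ha
  set b := {h : (ZMod (k.n ^ 2))ˣ | ¬ k.IsNthResidue h ∧ h ^ s = 1}.ncard with hb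
  set c := Nat.card {h : (ZMod (k.n ^ 2))ˣ // k.IsNthResidue h} with hc
  set d := Nat.card {h : (ZMod (k.n ^ 2))ˣ // ¬ k.IsNthResidue h} with hd
  have hS : Nat.card (powMonoidHom s : (ZMod (k.n ^ 2))ˣ →* _).ker = a + b := by
    have := Set.ncard_inter_add_ncard_sdiff_eq_ncard {h : (ZMod (k.n ^ 2))ˣ | h ^ s = 1}
      {h | k.IsNthResidue h}
    rw [show Nat.card (powMonoidHom s : (ZMod (k.n ^ 2))ˣ →* _).ker =
      {h : (ZMod (k.n ^ 2))ˣ | h ^ s = 1}.ncard from rfl, ← this, ha, hb]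
    congr 2 <;> ext h <;> simp [and_comm]
  have hG : Nat.card (ZMod (k.n ^ 2))ˣ = c + d := by
    simp only [hc, hd, Nat.card_eq_fintype_card]
    rw [Fintype.card_subtype_compl]
    have := Fintype.card_subtype_le (α := (ZMod (k.n ^ 2))ˣ) k.IsNthResidue
    omega
  have hI : Nat.card ((powMonoidHom s).ker ⊓ (powMonoidHom k.n : (ZMod (k.n ^ 2))ˣ →* _).range :
      Subgroup (ZMod (k.n ^ 2))ˣ) = a := by
    change Set.ncard (((powMonoidHom s).ker ⊓ (powMonoidHom k.n).range :
      Subgroup (ZMod (k.n ^ 2))ˣ) : Set (ZMod (k.n ^ 2))ˣ) = a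
    rw [ha]
    congr 1
    ext h
    exact and_comm
  have hR : Nat.card (powMonoidHom k.n : (ZMod (k.n ^ 2))ˣ →* _).range = c := rfl
  -- Now `hcard` reads `(a + b) * c ≤ a * (c + d)`, that is `b * c ≤ a * d`, which is the claim `b /
  -- d ≤ a / c`.
  rw [hS, hG, hI, hR] at hcard
  have hc0 : c ≠ 0 := Nat.card_pos.ne'
  have hd0 : d ≠ 0 := Nat.card_pos.ne'
  rw [ENNReal.div_le_iff (by simpa using hd0) (by simp), div_eq_mul_inv, mul_assoc,
    mul_comm _ (d : ℝ≥0∞), ← mul_assoc, ← div_eq_mul_inv,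
    ENNReal.le_div_iff_mul_le (by simp [hc0]) (by simp)]
  norm_cast
  nlinarith

theorem Key.prob_pow_sk_residue (k : Key) :
    (∑' h, k.randomResidue h * if h.1 ^ k.sk = 1 then 1 else 0) = 1 := by
  refine Eq.trans (tsum_congr fun h => ?_) k.randomResidue.tsum_coe
  rw [if_pos ((k.pow_sk_eq_one_iff _).2 h.2), mul_one]

theorem Key.prob_pow_sk_nonresidue (k : Key) :
    (∑' h, k.randomNonresidue h * if h.1 ^ k.sk = 1 then 1 else 0) = 0 := by
  refine ENNReal.tsum_eq_zero.2 fun h => ?_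
  rw [if_neg ((k.pow_sk_eq_one_iff _).not.2 h.2), mul_zero]

/-- A unit modulo `n² > 1` is nonzero, so the test `≤ 1` of the program amounts to `= 1`. -/
theorem Key.val_pow_mod_le_one_iff (k : Key) (h : (ZMod (k.n ^ 2))ˣ) (s : ℕ) :
    (h : ZMod (k.n ^ 2)).val ^ s % (k.n * k.n) ≤ 1 ↔ h ^ s = 1 := by
  have hn : 1 < k.n ^ 2 := Nat.one_lt_pow two_ne_zero k.one_lt_n
  have : Fact (1 < k.n ^ 2) := ⟨hn⟩
  have hv : (h : ZMod (k.n ^ 2)).val ^ s % (k.n * k.n) =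
      ((h ^ s : (ZMod (k.n ^ 2))ˣ) : ZMod (k.n ^ 2)).val := by
    rw [← pow_two, ← ZMod.val_natCast]
    simp
  rw [hv, ← Units.val_inj, Units.val_one]
  constructor
  · intro hle
    have h0 : ((h ^ s : (ZMod (k.n ^ 2))ˣ) : ZMod (k.n ^ 2)).val ≠ 0 := by
      rw [Ne, ZMod.val_eq_zero]
      exact Units.ne_zero _
    exact (ZMod.val_eq_one hn _).1 (by omega)
  · intro h1
    rw [h1, ZMod.val_one]

/-! ### The comparison key -/

theorem tsum_bind_mul {α β : Type} (m : PMF α) (f : α → PMF β) (g : β → ℝ≥0∞) :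
    ∑' b, m.bind f b * g b = ∑' a, m a * ∑' b, f a b * g b := by
  simp only [PMF.bind_apply, ← ENNReal.tsum_mul_right, ← ENNReal.tsum_mul_left, mul_assoc]
  exact ENNReal.tsum_comm

theorem tsum_pure_mul {β : Type} (b : β) (g : β → ℝ≥0∞) : ∑' x, PMF.pure b x * g x = g b := by
  rw [tsum_eq_single b]
  · simp [PMF.pure_apply]
  · intro x hx
    simp [PMF.pure_apply, hx]

theorem tsum_uniformOfFintype_mul {α : Type} [Fintype α] [Nonempty α] (g : α → ℝ≥0∞) :
    ∑' a, PMF.uniformOfFintype α a * g a = (Fintype.card α : ℝ≥0∞)⁻¹ * ∑ a, g a := by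
  simp only [PMF.uniformOfFintype_apply, tsum_fintype, ← Finset.mul_sum]

theorem Key.tsum_randomComparisonKey (k : Key) (g : ℕ × ℕ → ℝ≥0∞) :
    ∑' ck, k.randomComparisonKey ck * g ck =
      (k.sk : ℝ≥0∞)⁻¹ * ∑ u : (ZMod k.n)ˣ, ((k.sk : ℝ≥0∞)⁻¹ *
        ∑ v : (ZMod k.n)ˣ, g ((u : ZMod k.n).val, (v : ZMod k.n).val)) := by
  have hcard : Fintype.card (ZMod k.n)ˣ = k.sk := ZMod.card_units_eq_totient _
  simp only [Key.randomComparisonKey, tsum_bind_mul, tsum_pure_mul]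
  -- For each `ζ` the average over `η₀, η₁` has the same value, so averaging over `ζ` changes
  -- nothing.
  refine Eq.trans (tsum_congr fun ζ => ?_) ((ENNReal.tsum_mul_right).trans
    (by rw [(PMF.uniformOfFintype (ZMod k.n)ˣ).tsum_coe, one_mul]))
  congr 1
  simp only [tsum_uniformOfFintype_mul, hcard, Key.comparisonKey]
  congr 1
  refine Eq.trans (Finset.sum_congr rfl fun η₀ _ => ?_) (Equiv.sum_comp
    (Equiv.mulRight (k.phi ^ (ζ : ZMod k.n).val)) fun u : (ZMod k.n)ˣ => (k.sk : ℝ≥0∞)⁻¹ *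
      ∑ v : (ZMod k.n)ˣ, g ((u : ZMod k.n).val, (v : ZMod k.n).val))
  congr 1
  exact Equiv.sum_comp (Equiv.mulRight (k.phi ^ (ζ : ZMod k.n).val)⁻¹) fun v : (ZMod k.n)ˣ =>
    g (((Equiv.mulRight (k.phi ^ (ζ : ZMod k.n).val) η₀ : (ZMod k.n)ˣ) : ZMod k.n).val,
      (v : ZMod k.n).val)

/-- The factor 8 is `2 · 2 · 2`, from `2 ^ n.size ≤ 2 n`, `p ≤ 2 (p - 1)` and `q ≤ 2 (q - 1)`. -/
theorem Key.two_pow_size_le (k : Key) : 2 ^ k.n.size ≤ 8 * k.sk := by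
  have hp := k.p_prime.two_le
  have hq := k.q_prime.two_le
  have h1 : 2 ^ (k.n.size - 1) ≤ k.n := by
    have : 0 < k.n.size := Nat.size_pos.2 (Nat.pos_of_neZero _)
    exact Nat.lt_size.1 (by omega)
  have h2 : 2 ^ k.n.size ≤ 2 * 2 ^ (k.n.size - 1) := by
    rw [← pow_succ']
    exact Nat.pow_le_pow_right (by norm_num) (by omega)
  have h3 : k.n ≤ 2 * (k.p - 1) * (2 * (k.q - 1)) := Nat.mul_le_mul (by omega) (by omega)
  rw [k.sk_eq]
  calc 2 ^ k.n.size ≤ 2 * (2 * (k.p - 1) * (2 * (k.q - 1))) := by omega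
    _ = 8 * ((k.p - 1) * (k.q - 1)) := by ring

theorem Key.average_units_le (k : Key) (f g : ℕ → ℝ≥0∞) {C : ℝ≥0∞}
    (hfg : ∀ c, f c ≤ C * g c) :
    (k.sk : ℝ≥0∞)⁻¹ * ∑ u : (ZMod k.n)ˣ, f (u : ZMod k.n).val ≤
      8 * C * ((2 ^ k.n.size)⁻¹ * ∑ c ∈ Finset.range (2 ^ k.n.size), g c) := by
  classical
  have h1 : (k.sk : ℝ≥0∞)⁻¹ ≤ 8 * (2 ^ k.n.size)⁻¹ := by
    have h := k.two_pow_size_le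
    rw [← div_eq_mul_inv, ENNReal.le_div_iff_mul_le (by simp) (by simp), mul_comm,
      ← div_eq_mul_inv]
    refine ENNReal.div_le_of_le_mul ?_
    exact_mod_cast h
  have hinj : Function.Injective fun u : (ZMod k.n)ˣ => (u : ZMod k.n).val :=
    (ZMod.val_injective k.n).comp Units.val_injective
  have h2 : ∑ u : (ZMod k.n)ˣ, f (u : ZMod k.n).val ≤
      ∑ c ∈ Finset.range (2 ^ k.n.size), f c := by
    rw [← Finset.sum_image (f := f) fun _ _ _ _ h => hinj h]
    refine Finset.sum_le_sum_of_subset fun c hc => ?_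
    obtain ⟨u, -, rfl⟩ := Finset.mem_image.1 hc
    exact Finset.mem_range.2 ((ZMod.val_lt _).trans (Nat.lt_size_self _))
  refine (mul_le_mul' h1 (h2.trans (Finset.sum_le_sum fun c _ => hfg c))).trans_eq ?_
  rw [← Finset.mul_sum]
  ring

/-! ### The advantage of the distinguisher -/

/-- The probability that `A` outputs `s` on the modulus `n` and a pair of random numbers of the
length of `n`. -/
noncomputable def guessProb (A : Prog) (κ n s : ℕ) : ℝ≥0∞ :=
  (2 ^ n.size)⁻¹ * ∑ c₀ ∈ Finset.range (2 ^ n.size),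
    ((2 ^ n.size)⁻¹ * ∑ c₁ ∈ Finset.range (2 ^ n.size), A.outputProb κ [n, c₀, c₁] s)

theorem Key.recovery_le_guessProb (k : Key) (A : Prog) (κ : ℕ) :
    ∑' ck, k.randomComparisonKey ck * A.outputProb κ [k.n, ck.1, ck.2] k.sk ≤
      64 * guessProb A κ k.n k.sk := by
  rw [k.tsum_randomComparisonKey fun ck => A.outputProb κ [k.n, ck.1, ck.2] k.sk]
  refine (k.average_units_le
    (fun c₀ => (k.sk : ℝ≥0∞)⁻¹ * ∑ v : (ZMod k.n)ˣ,
      A.outputProb κ [k.n, c₀, (v : ZMod k.n).val] k.sk) _ fun c₀ =>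
    k.average_units_le (C := 1) (fun c₁ => A.outputProb κ [k.n, c₀, c₁] k.sk) _
      fun c₁ => (one_mul _).ge).trans_eq ?_
  rw [guessProb]
  norm_num

theorem outputProb_distinguisher {M : ℕ} {A : Prog} (hA : A.RegsIn (· < M + 4)) (κ : ℕ) (k : Key)
    (h : (ZMod (k.n ^ 2))ˣ) :
    (distinguisher M A).outputProb κ [k.n, (h : ZMod (k.n ^ 2)).val] 1 =
      ∑' s, guessProb A κ k.n s * if h ^ s = 1 then 1 else 0 := by
  rw [exp_distinguisher hA κ _ _ k.one_lt_n]
  simp only [k.val_pow_mod_le_one_iff, guessProb]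
  simp only [mul_assoc, Finset.sum_mul, ENNReal.tsum_mul_left,
    Summable.tsum_finsetSum fun _ _ => ENNReal.summable]

theorem tsum_outputProb_distinguisher {M : ℕ} {A : Prog} (hA : A.RegsIn (· < M + 4)) (κ : ℕ)
    (k : Key) {P : (ZMod (k.n ^ 2))ˣ → Prop} (m : PMF {h // P h}) :
    ∑' h, m h * (distinguisher M A).outputProb κ [k.n, (h.1 : ZMod (k.n ^ 2)).val] 1 =
      ∑' s, guessProb A κ k.n s * ∑' h, m h * if h.1 ^ s = 1 then 1 else 0 := by
  simp only [outputProb_distinguisher hA, ← ENNReal.tsum_mul_left]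
  rw [ENNReal.tsum_comm]
  exact tsum_congr fun s => tsum_congr fun h => mul_left_comm _ _ _

/-- The inequality holds for each output `s` separately. It is stated with a sum because subtraction
in `ℝ≥0∞` is truncated. -/
theorem accept_add_guessProb_le {M : ℕ} {A : Prog} (hA : A.RegsIn (· < M + 4)) (κ : ℕ)
    (k : Key) :
    (∑' h, k.randomNonresidue h *
        (distinguisher M A).outputProb κ [k.n, (h.1 : ZMod (k.n ^ 2)).val] 1) +
      guessProb A κ k.n k.sk ≤ ∑' h, k.randomResidue h *
        (distinguisher M A).outputProb κ [k.n, (h.1 : ZMod (k.n ^ 2)).val] 1 := by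
  rw [tsum_outputProb_distinguisher hA, tsum_outputProb_distinguisher hA]
  rw [← tsum_ite_eq k.sk fun s => guessProb A κ k.n s, ← ENNReal.tsum_add]
  refine ENNReal.tsum_le_tsum fun s => ?_
  split_ifs with hs
  · rw [hs, k.prob_pow_sk_residue, k.prob_pow_sk_nonresidue, mul_zero, zero_add, mul_one]
  · rw [add_zero]
    exact mul_le_mul' le_rfl (k.prob_pow_eq_one_le s)

theorem keyRecoveryProb_add_le (Gen : ℕ → PMF Key) {M : ℕ} {A : Prog}
    (hA : A.RegsIn (· < M + 4)) (κ : ℕ) :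
    64 * acceptNonresidueProb Gen (distinguisher M A) κ + keyRecoveryProb Gen A κ ≤
      64 * acceptResidueProb Gen (distinguisher M A) κ := by
  simp only [acceptNonresidueProb, keyRecoveryProb, acceptResidueProb, ← ENNReal.tsum_mul_left,
    ← ENNReal.tsum_add]
  refine ENNReal.tsum_le_tsum fun k => ?_
  simp only [ENNReal.tsum_mul_left]
  rw [mul_left_comm, mul_left_comm 64, ← mul_add]
  refine mul_le_mul' le_rfl ((add_le_add le_rfl (k.recovery_le_guessProb A κ)).trans ?_)
  rw [← mul_add]
  exact mul_le_mul' le_rfl (accept_add_guessProb_le hA κ k)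

theorem tsum_mul_le_one {α : Type} (m : PMF α) {g : α → ℝ≥0∞} (hg : ∀ a, g a ≤ 1) :
    ∑' a, m a * g a ≤ 1 :=
  (ENNReal.tsum_le_tsum fun a => mul_le_of_le_one_right' (hg a)).trans_eq m.tsum_coe

theorem acceptResidueProb_ne_top (Gen : ℕ → PMF Key) (D : Prog) (κ : ℕ) :
    acceptResidueProb Gen D κ ≠ ⊤ :=
  ((tsum_mul_le_one _ fun _ => tsum_mul_le_one _ fun _ =>
    iSup_le fun _ => PMF.coe_le_one _ _).trans_lt ENNReal.one_lt_top).ne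

end HOPE

/-! ### Reduction of key recovery to the residue problem -/

theorem mainTheorem2 (Gen : ℕ → PMF HOPE.Key) (hres : HOPE.NthResidueIntractable Gen)
    (A : HOPE.Prog) (hA : HOPE.IsPPT 3 A) :
    HOPE.Negligible fun κ => (HOPE.keyRecoveryProb Gen A κ).toReal := by
  obtain ⟨M, hM⟩ := A.exists_regsIn
  -- Adding 4 keeps the input registers `0, …, 3` of `A` below the scratch registers, even where `A`
  -- does not name them.
  have hM' : A.RegsIn (· < M + 4) := hM.mono fun i hi => by omega
  refine Asymptotics.SuperpolynomialDecay.trans_abs_le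
    ((hres _ (HOPE.isPPT_distinguisher hM' hA)).const_mul 64) fun κ => ?_
  have h := HOPE.keyRecoveryProb_add_le Gen hM' κ
  have htop := ENNReal.mul_ne_top (a := 64) (by simp)
    (HOPE.acceptResidueProb_ne_top Gen (HOPE.distinguisher M A) κ)
  have h1 := ENNReal.toReal_mono htop h
  rw [ENNReal.toReal_add (ne_top_of_le_ne_top htop (le_self_add.trans h))
    (ne_top_of_le_ne_top htop (le_add_self.trans h)), ENNReal.toReal_mul, ENNReal.toReal_mul,
    ENNReal.toReal_ofNat] at h1
  rw [abs_of_nonneg ENNReal.toReal_nonneg, abs_mul, abs_abs]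
  have h2 := le_abs_self ((HOPE.acceptResidueProb Gen (HOPE.distinguisher M A) κ).toReal -
    (HOPE.acceptNonresidueProb Gen (HOPE.distinguisher M A) κ).toReal)
  norm_num
  linarith
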